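/- Let $k$ be a field and $n\ge 2$. For $R=\mathbb N$ (resp. $R=\mathbb Z$) let $H(n)$ (resp. $H_\infty(n)$) be the free Hopf algebra (resp. free Hopf algebra with bijective antipode) on the $n\times n$ matrix coalgebra, given by its standard presentation: as a $k$-algebra it is generated by $x^r_{ij}$ ($r\in R$, $1\le i,j\le n$) subject to $$\sum_{a} x^r_{ia}x^{r+1}_{ja}=\delta_{ij}=\sum_{a} x^{r+1}_{ai}x^r_{aj}\qquad(r\in R,\ 1\le i,j\le n).$$ For $d\ge 1$ and an invertible $n\times n$ matrix $F$ over $k$, let $H_d(F)$ be the Hopf algebra which as a $k$-algebra is generated by $x^r_{ij}$ ($r\in\mathbb Z/2d$, $1\le i,j\le n$) subject to the same relations for $r=0,\dots,2d-2$ together with $(X^{2d-1})^{-1}=F(X^0)^tF^{-1}$, where $X^r=(x^r_{ij})_{i,j}$. Consider the reductions $$\text{(red1)}\quad x^r_{in}x^{r+1}_{jn}\to\delta_{ij}-\sum_{a<n}x^r_{ia}x^{r+1}_{ja}\quad(r\text{ even}),$$ $$\text{(red2)}\quad x^r_{i1}x^{r+1}_{j1}\to\delta_{ij}-\sum_{a>1}x^r_{ia}x^{r+1}_{ja}\quad(r\text{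 odd}),$$ $$\text{(red3)}\quad x^{r+1}_{ni}x^r_{nj}\to\delta_{ij}-\sum_{a<n}x^{r+1}_{ai}x^r_{aj}\quad(r\text{ odd}),$$ $$\text{(red4)}\quad x^{r+1}_{1i}x^r_{1j}\to\delta_{ij}-\sum_{a>1}x^{r+1}_{ai}x^r_{aj}\quad(r\text{ even}),$$ $$\text{(red5)}\quad x^{2d-1}_{i1}x^0_{j1}\to F_{11}^{-1}F_{jj}\Big(\delta_{ij}-\sum_{(l,p,u)\ne(1,1,j)}F_{lp}(F^{-1})_{uj}\,x^{2d-1}_{il}x^0_{up}\Big),$$ $$\text{(red6)}\quad x^0_{ni}x^{2d-1}_{nj}\to F_{ii}^{-1}F_{nn}\Big(\delta_{ij}-\sum_{(p,u,l)\ne(i,n,n)}F_{ip}(F^{-1})_{ul}\,x^0_{up}x^{2d-1}_{lj}\Big),$$ for all $1\le i,j\le n$. We say that Bergman's diamond lemma is applicable to a system of reductions $W_\sigma\to f_\sigma$ if there is a semigroup partial order on the words in the generators which satisfies the descending chain condition and for which every $f_\sigma$ is a linear combination of words smaller than $W_\sigma$, and if all overlap and inclusion ambiguities of the system are resolvable.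 (a) For $H(n)$ and for $H_\infty(n)$, the diamond lemma is applicable to the reductions (red1)–(red4), with $r$ ranging over $\mathbb N$, respectively $\mathbb Z$, and the words in the $x^r_{ij}$ that contain no left-hand side of these reductions as a subword form a $k$-basis of the algebra. (b) Let $d\ge1$ and let $F$ be an invertible upper triangular $n\times n$ matrix. For $H_d(F)$, the diamond lemma is applicable to the reductions (red1)–(red4) for $r=0,\dots,2d-2$ together with (red5) and (red6), and the words in the $x^r_{ij}$ that contain no left-hand side of these reductions as a subword form a $k$-basis of $H_d(F)$. -/

import Mathlib

noncomputable section

namespace UniversalQuantumGroup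

/-! ### Reduction systems in a free algebra and the diamond lemma -/

section Diamond

variable (k : Type*) [Field k] {X : Type*}

/-- The monomial in the free algebra `k⟨X⟩` given by a word in `X`. -/
def word : FreeMonoid X →* FreeAlgebra k X :=
  FreeMonoid.lift (FreeAlgebra.ι k)

/-- A rule `W → f`, with `W` a word and `f` an element of the free algebra. -/
abbrev Rule (X : Type*) := FreeMonoid X × FreeAlgebra k X

variable {k}

open Classical in
/-- The reduction `r_{AσB}`: the linear endomorphism of `k⟨X⟩` that sends the word `A W_σ B`
to `A f_σ B` and fixes every other word. -/
def reduction (A : FreeMonoid X) (σ : Rule k X) (B : FreeMonoid X) :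
    Module.End k (FreeAlgebra k X) :=
  (FreeAlgebra.basisFreeMonoid k X).constr k fun w =>
    if w = A * σ.1 * B then word k A * σ.2 * word k B else word k w

/-- Finite compositions of reductions of the system `S`. -/
def reductionMonoid (S : Set (Rule k X)) : Submonoid (Module.End k (FreeAlgebra k X)) :=
  Submonoid.closure {ρ | ∃ A B, ∃ σ ∈ S, ρ = reduction A σ B}

/-- Two elements can be reduced to a common element. -/
def Joinable (S : Set (Rule k X)) (f g : FreeAlgebra k X) : Prop :=
  ∃ ρ ∈ reductionMonoid S, ∃ ρ' ∈ reductionMonoid S, ρ f = ρ' g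

/-- All overlap ambiguities (`W_σ = AB`, `W_τ = BC`, with `A, B, C` nonempty) are resolvable. -/
def OverlapsResolvable (S : Set (Rule k X)) : Prop :=
  ∀ σ ∈ S, ∀ τ ∈ S, ∀ A B C : FreeMonoid X, A ≠ 1 → B ≠ 1 → C ≠ 1 →
    σ.1 = A * B → τ.1 = B * C → Joinable S (σ.2 * word k C) (word k A * τ.2)

/-- All inclusion ambiguities (`σ ≠ τ`, `W_σ = B`, `W_τ = ABC`) are resolvable. -/
def InclusionsResolvable (S : Set (Rule k X)) : Prop :=
  ∀ σ ∈ S, ∀ τ ∈ S, σ ≠ τ → ∀ A C : FreeMonoid X,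
    τ.1 = A * σ.1 * C → Joinable S (word k A * σ.2 * word k C) τ.2

/-- `lt` is (the strict part of) a semigroup partial order on the words with the descending chain
condition, and it is compatible with `S`: each `f_σ` is a linear combination of words that are
smaller than `W_σ`. -/
structure IsCompatibleOrder (S : Set (Rule k X)) (lt : FreeMonoid X → FreeMonoid X → Prop) :
    Prop where
  strictOrder : IsStrictOrder (FreeMonoid X) lt
  semigroup : ∀ A C B B' : FreeMonoid X, lt B B' → lt (A * B * C) (A * B' * C)
  descendingChain : WellFounded lt
  compatible : ∀ σ ∈ S, σ.2 ∈ Submodule.span k (word k '' {w | lt w σ.1})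

/-- The hypotheses of Bergman's diamond lemma hold for the reduction system `S`. -/
def DiamondLemmaApplicable (S : Set (Rule k X)) : Prop :=
  (∃ lt, IsCompatibleOrder S lt) ∧ OverlapsResolvable S ∧ InclusionsResolvable S

/-- The words that contain no left-hand side of a rule of `S` as a subword. -/
def irreducibleWords (S : Set (Rule k X)) : Set (FreeMonoid X) :=
  {w | ∀ σ ∈ S, ∀ A B : FreeMonoid X, w ≠ A * σ.1 * B}

/-- The images under `π` of the irreducible words (pairwise distinct) form a `k`-basis of `H`. -/
def IrreducibleWordsFormBasis (S : Set (Rule k X)) {H : Type*} [Ring H] [Algebra k H]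
    (π : FreeAlgebra k X →ₐ[k] H) : Prop :=
  ∃ b : Module.Basis (irreducibleWords S) k H, ∀ w, b w = π (word k (w : FreeMonoid X))

end Diamond

/-! ### The algebras -/

/-- The symbols `x^r_{ij}`, encoded as triples `(r, i, j)`. -/
abbrev Gen (R : Type*) (n : ℕ) := R × Fin n × Fin n

/-- The free algebra on the symbols `x^r_{ij}`. -/
abbrev FreeGen (k : Type*) [Field k] (R : Type*) (n : ℕ) := FreeAlgebra k (Gen R n)

section Algebras

variable (k : Type*) [Field k] (n : ℕ)

/-- The matrix `X^r = (x^r_{ij})` over the free algebra. -/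
def genMatrix {R : Type*} (r : R) : Matrix (Fin n) (Fin n) (FreeGen k R n) :=
  Matrix.of fun i j => FreeAlgebra.ι k (r, i, j)

/-- The Kronecker symbol, in the free algebra. -/
def kron {R : Type*} (i j : Fin n) : FreeGen k R n := if i = j then 1 else 0

/-- The relations `∑ₐ x^r_{ia} x^{r+1}_{ja} = δ_{ij} = ∑ₐ x^{r+1}_{ai} x^r_{aj}`, `r ∈ R`. -/
inductive FreeRel (R : Type*) [Semiring R] : FreeGen k R n → FreeGen k R n → Prop
  | left (r : R) (i j : Fin n) :
      FreeRel R (∑ a, genMatrix k n r i a * genMatrix k n (r + 1) j a) (kron k n i j)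
  | right (r : R) (i j : Fin n) :
      FreeRel R (∑ a, genMatrix k n (r + 1) a i * genMatrix k n r a j) (kron k n i j)

/-- The algebra underlying `H(n)` when `R = ℕ` and `H_∞(n)` when `R = ℤ`. -/
abbrev FreeHopf (R : Type*) [Semiring R] := RingQuot (FreeRel k n R)

variable {n}

/-- The matrix `F (X^0)ᵗ F⁻¹` over the free algebra on the `x^r_{ij}`, `r ∈ ℤ/2d`. -/
def twist (d : ℕ) (F : GL (Fin n) k) : Matrix (Fin n) (Fin n) (FreeGen k (ZMod (2 * d)) n) :=
  (F : Matrix (Fin n) (Fin n) k).map (algebraMap k _) *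
    (genMatrix k n (0 : ZMod (2 * d))).transpose *
    ((F⁻¹ : GL (Fin n) k) : Matrix (Fin n) (Fin n) k).map (algebraMap k _)

/-- The relations of `H_d(F)`: those of `FreeRel` for `r = 0, …, 2d - 2`, together with
`(X^{2d-1})⁻¹ = F (X^0)ᵗ F⁻¹`. The index `2d - 1` of `ℤ/2d` is written `-1`. -/
inductive TwistedRel (d : ℕ) (F : GL (Fin n) k) :
    FreeGen k (ZMod (2 * d)) n → FreeGen k (ZMod (2 * d)) n → Prop
  | left (r : ℕ) (hr : r + 2 ≤ 2 * d) (i j : Fin n) :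
      TwistedRel d F
        (∑ a, genMatrix k n (r : ZMod (2 * d)) i a * genMatrix k n ((r : ZMod (2 * d)) + 1) j a)
        (kron k n i j)
  | right (r : ℕ) (hr : r + 2 ≤ 2 * d) (i j : Fin n) :
      TwistedRel d F
        (∑ a, genMatrix k n ((r : ZMod (2 * d)) + 1) a i * genMatrix k n (r : ZMod (2 * d)) a j)
        (kron k n i j)
  | twistLeft (i j : Fin n) :
      TwistedRel d F ((genMatrix k n (-1 : ZMod (2 * d)) * twist k d F) i j) (kron k n i j)
  | twistRight (i j : Fin n) :
      TwistedRel d F ((twist k d F * genMatrix k n (-1 : ZMod (2 * d))) i j) (kron k n i j)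

/-- The algebra underlying `H_d(F)`. -/
abbrev TwistedHopf (d : ℕ) (F : GL (Fin n) k) := RingQuot (TwistedRel k d F)

end Algebras

/-! ### The reductions -/

section Reductions

variable (k : Type*) [Field k] {n : ℕ} [NeZero n] {R : Type*}

/-- The index called `1` on paper. -/
def first : Fin n := ⟨0, NeZero.pos n⟩

/-- The index called `n` on paper. -/
def last : Fin n := ⟨n - 1, Nat.sub_lt (NeZero.pos n) one_pos⟩

/-- The two-letter word `x^r_{ij} x^s_{lm}`. -/
def pair (r : R) (i j : Fin n) (s : R) (l m : Fin n) : FreeMonoid (Gen R n) :=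
  FreeMonoid.of (r, i, j) * FreeMonoid.of (s, l, m)

/-- `x^r_{in} x^s_{jn} → δ_{ij} - ∑_{a<n} x^r_{ia} x^s_{ja}` -/
def red1 (r s : R) (i j : Fin n) : Rule k (Gen R n) :=
  (pair r i last s j last,
    kron k n i j - ∑ a with a < last, genMatrix k n r i a * genMatrix k n s j a)

/-- `x^r_{i1} x^s_{j1} → δ_{ij} - ∑_{a>1} x^r_{ia} x^s_{ja}` -/
def red2 (r s : R) (i j : Fin n) : Rule k (Gen R n) :=
  (pair r i first s j first,
    kron k n i j - ∑ a with first < a, genMatrix k n r i a * genMatrix k n s j a)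

/-- `x^s_{ni} x^r_{nj} → δ_{ij} - ∑_{a<n} x^s_{ai} x^r_{aj}` -/
def red3 (r s : R) (i j : Fin n) : Rule k (Gen R n) :=
  (pair s last i r last j,
    kron k n i j - ∑ a with a < last, genMatrix k n s a i * genMatrix k n r a j)

/-- `x^s_{1i} x^r_{1j} → δ_{ij} - ∑_{a>1} x^s_{ai} x^r_{aj}` -/
def red4 (r s : R) (i j : Fin n) : Rule k (Gen R n) :=
  (pair s first i r first j,
    kron k n i j - ∑ a with first < a, genMatrix k n s a i * genMatrix k n r a j)

/-- The reductions attached to an even `r`, with `s = r + 1`. -/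
def evenRules (r s : R) : Set (Rule k (Gen R n)) :=
  {σ | ∃ i j, σ = red1 k r s i j ∨ σ = red4 k r s i j}

/-- The reductions attached to an odd `r`, with `s = r + 1`. -/
def oddRules (r s : R) : Set (Rule k (Gen R n)) :=
  {σ | ∃ i j, σ = red2 k r s i j ∨ σ = red3 k r s i j}

variable (n) in
/-- The reduction system for `H(n)` (`R = ℕ`) and for `H_∞(n)` (`R = ℤ`). -/
def freeReductions (R : Type*) [Semiring R] : Set (Rule k (Gen R n)) :=
  {σ | ∃ r : R, (Even r ∧ σ ∈ evenRules k r (r + 1)) ∨ (Odd r ∧ σ ∈ oddRules k r (r + 1))}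

variable {k} (d : ℕ) (F : GL (Fin n) k)

/-- `x^{2d-1}_{i1} x^0_{j1} → F_{11}⁻¹ F_{jj} (δ_{ij} -
∑_{(l,p,u) ≠ (1,1,j)} F_{lp} (F⁻¹)_{uj} x^{2d-1}_{il} x^0_{up})` -/
def red5 (i j : Fin n) : Rule k (Gen (ZMod (2 * d)) n) :=
  (pair (-1) i first 0 j first,
    ((F first first)⁻¹ * F j j) • (kron k n i j -
      ∑ t : Fin n × Fin n × Fin n with t ≠ (first, first, j),
        (F t.1 t.2.1 * (F⁻¹ : GL (Fin n) k) t.2.2 j) •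
          (genMatrix k n (-1) i t.1 * genMatrix k n 0 t.2.2 t.2.1)))

/-- `x^0_{ni} x^{2d-1}_{nj} → F_{ii}⁻¹ F_{nn} (δ_{ij} -
∑_{(p,u,l) ≠ (i,n,n)} F_{ip} (F⁻¹)_{ul} x^0_{up} x^{2d-1}_{lj})` -/
def red6 (i j : Fin n) : Rule k (Gen (ZMod (2 * d)) n) :=
  (pair 0 last i (-1) last j,
    ((F i i)⁻¹ * F last last) • (kron k n i j -
      ∑ t : Fin n × Fin n × Fin n with t ≠ (i, last, last),
        (F i t.1 * (F⁻¹ : GL (Fin n) k) t.2.1 t.2.2) •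
          (genMatrix k n 0 t.2.1 t.1 * genMatrix k n (-1) t.2.2 j)))

/-- The reduction system for `H_d(F)`. -/
def twistedReductions : Set (Rule k (Gen (ZMod (2 * d)) n)) :=
  {σ | ∃ r : ℕ, r + 2 ≤ 2 * d ∧
      ((Even r ∧ σ ∈ evenRules k (r : ZMod (2 * d)) ((r : ZMod (2 * d)) + 1)) ∨
        (Odd r ∧ σ ∈ oddRules k (r : ZMod (2 * d)) ((r : ZMod (2 * d)) + 1)))} ∪
    {σ | ∃ i j, σ = red5 d F i j ∨ σ = red6 d F i j}

end Reductions

end UniversalQuantumGroup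

end

/-! The relations say that certain matrices vanish: `P = X Yᵗ - 1` and `Q = Yᵗ X - 1` for
consecutive `X = X^r`, `Y = X^{r+1}`, and, at the closing step of `H_d(F)`, `T = X G - 1` and `U = G
X - 1` with `X = X^{2d-1}` and `G = F (X^0)ᵗ F⁻¹`. Each reduction solves one entry of one of these
matrices, up to a nonzero scalar, for one quadratic monomial. For a suitable word order, with
directions that alternate with the parity of `r`, this monomial is the largest one in the entry; at
the closing step this is where the triangularity of `F` enters.

All ambiguities are resolved by matrix identities. Overlaps come from associativity: `P X = X Q`, `Q
Yᵗ = Yᵗ P`, `T X = X U`, and a conjugated form of `U G = G T`. In an entry of such an identity, one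
term on each side is a relator leading with the ambiguous word, and all other terms are relators
leading with smaller words. Inclusions between distinct rules arise only if two superscripts are
linked in both directions, that is for `d = 1`; there two rules share a left-hand side, and trace
identities between `P` and `U`, and between `Q` and `T`, settle the matter.

This is resolvability relative to the order. Bergman's argument then shows that any two relators `A
(W_σ - f_σ) B` with the same leading word differ by relators with smaller ones, so one relator for
each reducible word already spans the ideal, in triangular form. Hence the ideal meets the span of
the irreducible words in zero (`relators_disjoint_irreducibleSpan`). Termination brings every
element into that span modulo the ideal (`exists_reduction_irreducible`). The basis and the
joinability of all ambiguities follow.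

Since `red2` and `red3` are `red5` and `red6` at `F = 1`, a single system, `edgeReductions`, covers
all three algebras. -/

namespace UniversalQuantumGroup

/-! ### Bergman's diamond lemma: ambiguities resolvable relative to an order -/

section DiamondLemma

variable {k : Type*} [Field k] {X : Type*}

theorem basisFreeMonoid_apply (w : FreeMonoid X) :
    FreeAlgebra.basisFreeMonoid k X w = word k w := by
  simp [FreeAlgebra.basisFreeMonoid, FreeAlgebra.equivMonoidAlgebraFreeMonoid, word]

theorem span_range_word : Submodule.span k (Set.range (word k (X := X))) = ⊤ := by
  rw [← (FreeAlgebra.basisFreeMonoid k X).span_eq]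
  congr 2
  ext w
  exact (basisFreeMonoid_apply w).symm

theorem linearIndependent_word : LinearIndependent k (word k (X := X)) := by
  have h := (FreeAlgebra.basisFreeMonoid k X).linearIndependent
  rwa [show (⇑(FreeAlgebra.basisFreeMonoid k X)) = word k (X := X) from
    funext basisFreeMonoid_apply] at h

theorem repr_word (w : FreeMonoid X) :
    (FreeAlgebra.basisFreeMonoid k X).repr (word k w) = Finsupp.single w 1 := by
  rw [← basisFreeMonoid_apply, Module.Basis.repr_self]

open Classical in
theorem reduction_word (A : FreeMonoid X) (σ : Rule k X) (B w : FreeMonoid X) :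
    reduction A σ B (word k w) =
      if w = A * σ.1 * B then word k A * σ.2 * word k B else word k w := by
  rw [← basisFreeMonoid_apply, reduction, Module.Basis.constr_basis]
  simp only [basisFreeMonoid_apply]

/-- The span of the words below `w`. -/
def wordsBelow (k : Type*) [Field k] {X : Type*} (lt : FreeMonoid X → FreeMonoid X → Prop)
    (w : FreeMonoid X) : Submodule k (FreeAlgebra k X) :=
  Submodule.span k (word k '' {v | lt v w})

/-- The element `A (W_σ - f_σ) B` of the free algebra. -/
def relator (A : FreeMonoid X) (σ : Rule k X) (B : FreeMonoid X) : FreeAlgebra k X :=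
  word k A * (word k σ.1 - σ.2) * word k B

/-- The two-sided ideal generated by the differences `W_σ - f_σ`, as a subspace. -/
def relators (S : Set (Rule k X)) : Submodule k (FreeAlgebra k X) :=
  Submodule.span k {x | ∃ A B, ∃ σ ∈ S, x = relator A σ B}

/-- The span of the `A (W_σ - f_σ) B` with `A W_σ B` below `w`. -/
def relatorsBelow (S : Set (Rule k X)) (lt : FreeMonoid X → FreeMonoid X → Prop)
    (w : FreeMonoid X) : Submodule k (FreeAlgebra k X) :=
  Submodule.span k {x | ∃ A B, ∃ σ ∈ S, lt (A * σ.1 * B) w ∧ x = relator A σ B}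

/-- The span of the irreducible words. -/
def irreducibleSpan (S : Set (Rule k X)) : Submodule k (FreeAlgebra k X) :=
  Submodule.span k (word k '' irreducibleWords S)

theorem mul_mem_relators {S : Set (Rule k X)} {x : FreeAlgebra k X} (hx : x ∈ relators S)
    (a b : FreeAlgebra k X) : a * x * b ∈ relators S := by
  have ha : a ∈ Submodule.span k (Set.range (word k (X := X))) := by simp [span_range_word]
  have hb : b ∈ Submodule.span k (Set.range (word k (X := X))) := by simp [span_range_word]
  induction hx using Submodule.span_induction with
  | zero => simp
  | add x y _ _ hx hy => rw [mul_add, add_mul]; exact add_mem hx hy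
  | smul c x _ hx => rw [mul_smul_comm, smul_mul_assoc]; exact Submodule.smul_mem _ _ hx
  | mem x hx =>
    obtain ⟨A, B, σ, hσ, rfl⟩ := hx
    induction ha using Submodule.span_induction with
    | zero => simp
    | add x y _ _ hx hy => rw [add_mul, add_mul]; exact add_mem hx hy
    | smul c x _ hx => rw [smul_mul_assoc, smul_mul_assoc]; exact Submodule.smul_mem _ _ hx
    | mem x hx =>
      obtain ⟨A', rfl⟩ := hx
      induction hb using Submodule.span_induction with
      | zero => simp
      | add x y _ _ hx hy => rw [mul_add]; exact add_mem hx hy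
      | smul c x _ hx => rw [mul_smul_comm]; exact Submodule.smul_mem _ _ hx
      | mem x hx =>
        obtain ⟨B', rfl⟩ := hx
        refine Submodule.subset_span ⟨A' * A, B * B', σ, hσ, ?_⟩
        simp only [relator, map_mul, mul_assoc]

theorem rule_mem_relators {S : Set (Rule k X)} {σ : Rule k X} (hσ : σ ∈ S) :
    word k σ.1 - σ.2 ∈ relators S :=
  Submodule.subset_span ⟨1, 1, σ, hσ, by simp [relator]⟩

/-- Ambiguities are resolvable relative to the order `lt`. -/
structure ResolvableRelative (S : Set (Rule k X)) (lt : FreeMonoid X → FreeMonoid X → Prop) :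
    Prop where
  overlap : ∀ σ ∈ S, ∀ τ ∈ S, ∀ A B C : FreeMonoid X, A ≠ 1 → B ≠ 1 → C ≠ 1 →
    σ.1 = A * B → τ.1 = B * C →
      relator 1 σ C - relator A τ 1 ∈ relatorsBelow S lt (A * B * C)
  inclusion : ∀ σ ∈ S, ∀ τ ∈ S, ∀ A C : FreeMonoid X, τ.1 = A * σ.1 * C →
    relator A σ C - relator 1 τ 1 ∈ relatorsBelow S lt τ.1

variable {S : Set (Rule k X)} {lt : FreeMonoid X → FreeMonoid X → Prop}

namespace IsCompatibleOrder

theorem trans (h : IsCompatibleOrder S lt) {a b c : FreeMonoid X} (hab : lt a b) (hbc : lt b c) :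
    lt a c :=
  h.strictOrder.trans a b c hab hbc

theorem irrefl (h : IsCompatibleOrder S lt) (a : FreeMonoid X) : ¬ lt a a :=
  h.strictOrder.irrefl a

theorem mul_mem_wordsBelow (h : IsCompatibleOrder S lt) {w : FreeMonoid X} {x : FreeAlgebra k X}
    (hx : x ∈ wordsBelow k lt w) (A B : FreeMonoid X) :
    word k A * x * word k B ∈ wordsBelow k lt (A * w * B) := by
  induction hx using Submodule.span_induction with
  | zero => simp
  | add x y _ _ hx hy => rw [mul_add, add_mul]; exact add_mem hx hy
  | smul c x _ hx => rw [mul_smul_comm, smul_mul_assoc]; exact Submodule.smul_mem _ _ hx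
  | mem x hx =>
    obtain ⟨v, hv, rfl⟩ := hx
    exact Submodule.subset_span ⟨A * v * B, h.semigroup _ _ _ _ hv, by simp⟩

theorem mul_mem_relatorsBelow (h : IsCompatibleOrder S lt) {w : FreeMonoid X}
    {x : FreeAlgebra k X} (hx : x ∈ relatorsBelow S lt w) (A B : FreeMonoid X) :
    word k A * x * word k B ∈ relatorsBelow S lt (A * w * B) := by
  induction hx using Submodule.span_induction with
  | zero => simp
  | add x y _ _ hx hy => rw [mul_add, add_mul]; exact add_mem hx hy
  | smul c x _ hx => rw [mul_smul_comm, smul_mul_assoc]; exact Submodule.smul_mem _ _ hx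
  | mem x hx =>
    obtain ⟨A', B', σ, hσ, hlt, rfl⟩ := hx
    refine Submodule.subset_span ⟨A * A', B' * B, σ, hσ, ?_, ?_⟩
    · simpa only [mul_assoc] using h.semigroup A B _ _ hlt
    · simp only [relator, map_mul, mul_assoc]

theorem wordsBelow_mono (h : IsCompatibleOrder S lt) {v w : FreeMonoid X} (hvw : lt v w) :
    wordsBelow k lt v ≤ wordsBelow k lt w :=
  Submodule.span_mono (Set.image_mono fun _ hu => h.trans hu hvw)

theorem rule_mul_mem (h : IsCompatibleOrder S lt) {σ : Rule k X} (hσ : σ ∈ S) (M : FreeMonoid X)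
    {w : FreeMonoid X} {x : FreeAlgebra k X} (hx : x ∈ wordsBelow k lt w) :
    (word k σ.1 - σ.2) * word k M * x ∈ relatorsBelow S lt (σ.1 * M * w) := by
  induction hx using Submodule.span_induction with
  | zero => simp
  | add x y _ _ hx hy => rw [mul_add]; exact add_mem hx hy
  | smul c x _ hx => rw [mul_smul_comm]; exact Submodule.smul_mem _ _ hx
  | mem x hx =>
    obtain ⟨v, hv, rfl⟩ := hx
    refine Submodule.subset_span ⟨1, M * v, σ, hσ, ?_, ?_⟩
    · simpa [mul_assoc] using h.semigroup (σ.1 * M) 1 _ _ hv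
    · simp [relator, mul_assoc]

theorem mul_rule_mem (h : IsCompatibleOrder S lt) {σ : Rule k X} (hσ : σ ∈ S) (M : FreeMonoid X)
    {w : FreeMonoid X} {x : FreeAlgebra k X} (hx : x ∈ wordsBelow k lt w) :
    x * word k M * (word k σ.1 - σ.2) ∈ relatorsBelow S lt (w * M * σ.1) := by
  induction hx using Submodule.span_induction with
  | zero => simp
  | add x y _ _ hx hy => rw [add_mul, add_mul]; exact add_mem hx hy
  | smul c x _ hx => rw [smul_mul_assoc, smul_mul_assoc]; exact Submodule.smul_mem _ _ hx
  | mem x hx =>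
    obtain ⟨v, hv, rfl⟩ := hx
    refine Submodule.subset_span ⟨v * M, 1, σ, hσ, ?_, ?_⟩
    · simpa [mul_assoc] using h.semigroup 1 (M * σ.1) _ _ hv
    · simp [relator, mul_assoc]

/-- For disjoint occurrences the difference is `(W_σ - f_σ) M f_τ - f_σ M (W_τ - f_τ)`, and both
`f_σ` and `f_τ` consist of smaller words. -/
theorem disjoint_mem (h : IsCompatibleOrder S lt) {σ τ : Rule k X} (hσ : σ ∈ S) (hτ : τ ∈ S)
    (M : FreeMonoid X) :
    relator 1 σ (M * τ.1) - relator (σ.1 * M) τ 1 ∈ relatorsBelow S lt (σ.1 * M * τ.1) := by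
  have h1 := h.rule_mul_mem hσ M (h.compatible τ hτ)
  have h2 := h.mul_rule_mem hτ M (h.compatible σ hσ)
  have h3 : relator 1 σ (M * τ.1) - relator (σ.1 * M) τ 1 =
      (word k σ.1 - σ.2) * word k M * τ.2 - σ.2 * word k M * (word k τ.1 - τ.2) := by
    simp only [relator, map_mul, map_one]
    noncomm_ring
  rw [h3]
  exact sub_mem h1 h2

/-- The occurrence of `W_τ` starts after that of `W_σ` ends, or inside it; in the latter case it
ends inside `W_σ` or sticks out. These are the disjoint, inclusion and overlap cases, each padded by
the remaining letters. -/
theorem relator_sub_mem_of_prefix (h : IsCompatibleOrder S lt) (hS : ResolvableRelative S lt)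
    {σ τ : Rule k X} (hσ : σ ∈ S) (hτ : τ ∈ S) {M B B' : FreeMonoid X}
    (e : σ.1 * B = M * τ.1 * B') :
    relator 1 σ B - relator M τ B' ∈ relatorsBelow S lt (σ.1 * B) := by
  have e' : σ.1.toList ++ B.toList = M.toList ++ (τ.1.toList ++ B'.toList) := by
    simpa [mul_assoc] using congrArg FreeMonoid.toList e
  have inclusion_case : ∀ E : FreeMonoid X, σ.1 = M * τ.1 * E → B' = E * B →
      relator 1 σ B - relator M τ B' ∈ relatorsBelow S lt (σ.1 * B) := by
    rintro E hE rfl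
    have := h.mul_mem_relatorsBelow (hS.inclusion τ hτ σ hσ M E hE) 1 B
    rw [← neg_mem_iff]
    convert this using 1
    · simp
    · simp only [relator, map_mul, map_one]; noncomm_ring
  rcases List.append_eq_append_iff.1 e' with ⟨D, h1, h2⟩ | ⟨D, h1, h2⟩
  · have h1' : M = σ.1 * FreeMonoid.ofList D := FreeMonoid.toList.injective (by simpa using h1)
    have h2' : B = FreeMonoid.ofList D * τ.1 * B' :=
      FreeMonoid.toList.injective (by simpa using h2)
    have := h.mul_mem_relatorsBelow (h.disjoint_mem hσ hτ (FreeMonoid.ofList D)) 1 B'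
    subst h1' h2'
    convert this using 1
    · simp [mul_assoc]
    · simp only [relator, map_mul, map_one]; noncomm_ring
  · have h1' : σ.1 = M * FreeMonoid.ofList D := FreeMonoid.toList.injective (by simpa using h1)
    rcases List.append_eq_append_iff.1 h2 with ⟨E, h3, h4⟩ | ⟨E, h3, h4⟩
    · have h3' : FreeMonoid.ofList D = τ.1 * FreeMonoid.ofList E :=
        FreeMonoid.toList.injective (by simpa using h3)
      have h4' : B' = FreeMonoid.ofList E * B := FreeMonoid.toList.injective (by simpa using h4)
      exact inclusion_case (FreeMonoid.ofList E) (by rw [h1', h3', mul_assoc]) h4'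
    · have h3' : τ.1 = FreeMonoid.ofList D * FreeMonoid.ofList E :=
        FreeMonoid.toList.injective (by simpa using h3)
      have h4' : B = FreeMonoid.ofList E * B' := FreeMonoid.toList.injective (by simpa using h4)
      -- Overlaps have three nonempty pieces. If `E` or `M` is empty the configuration is an
      -- inclusion, and if `D` is empty the occurrences are adjacent, hence disjoint.
      by_cases hE : FreeMonoid.ofList E = 1
      · rw [hE, mul_one] at h3'
        exact inclusion_case 1 (by rw [h1', h3', mul_one]) (by rw [h4', hE]; simp)
      by_cases hM : M = 1
      · have := h.mul_mem_relatorsBelow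
          (hS.inclusion σ hσ τ hτ 1 (FreeMonoid.ofList E) (by rw [h1', h3', hM]; simp)) 1 B'
        subst h4'
        convert this using 1
        · rw [h1', hM]; simp [h3', mul_assoc]
        · simp only [relator, map_mul, map_one, hM]; noncomm_ring
      by_cases hD : FreeMonoid.ofList D = 1
      · have := h.mul_mem_relatorsBelow (h.disjoint_mem hσ hτ 1) 1 B'
        rw [hD, mul_one] at h1'
        rw [hD, one_mul] at h3'
        rw [← h3'] at h4'
        rw [← h1', h4']
        convert this using 1
        · simp [mul_assoc]
        · simp only [relator, map_mul, map_one]; noncomm_ring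
      · have := h.mul_mem_relatorsBelow
          (hS.overlap σ hσ τ hτ M (FreeMonoid.ofList D) (FreeMonoid.ofList E) hM hD hE h1' h3') 1 B'
        subst h4'
        convert this using 1
        · rw [h1']; simp [mul_assoc]
        · simp only [relator, map_mul, map_one]; noncomm_ring

/-- The part of the word before both occurrences is stripped off; which of them starts first is a
matter of symmetry. -/
theorem relator_sub_mem (h : IsCompatibleOrder S lt) (hS : ResolvableRelative S lt)
    {σ τ : Rule k X} (hσ : σ ∈ S) (hτ : τ ∈ S) {A B A' B' : FreeMonoid X}
    (e : A * σ.1 * B = A' * τ.1 * B') :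
    relator A σ B - relator A' τ B' ∈ relatorsBelow S lt (A * σ.1 * B) := by
  have key : ∀ {σ τ : Rule k X}, σ ∈ S → τ ∈ S → ∀ {A B B' D : FreeMonoid X},
      A * σ.1 * B = A * D * τ.1 * B' →
      relator A σ B - relator (A * D) τ B' ∈ relatorsBelow S lt (A * σ.1 * B) := by
    intro σ τ hσ hτ A B B' D e
    have e2 : σ.1 * B = D * τ.1 * B' := by
      refine mul_left_cancel (a := A) ?_
      simpa only [mul_assoc] using e
    have := h.mul_mem_relatorsBelow (h.relator_sub_mem_of_prefix hS hσ hτ e2) A 1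
    convert this using 1
    · simp [mul_assoc]
    · simp only [relator, map_mul, map_one]; noncomm_ring
  have e' : A.toList ++ (σ.1.toList ++ B.toList) = A'.toList ++ (τ.1.toList ++ B'.toList) := by
    simpa [mul_assoc] using congrArg FreeMonoid.toList e
  rcases List.append_eq_append_iff.1 e' with ⟨D, h1, -⟩ | ⟨D, h1, -⟩
  · have h1' : A' = A * FreeMonoid.ofList D := FreeMonoid.toList.injective (by simpa using h1)
    subst h1'
    exact key hσ hτ e
  · have h1' : A = A' * FreeMonoid.ofList D := FreeMonoid.toList.injective (by simpa using h1)
    subst h1'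
    rw [← neg_mem_iff, neg_sub, e]
    exact key hτ hσ e.symm

theorem relator_sub_word_mem (h : IsCompatibleOrder S lt) {σ : Rule k X} (hσ : σ ∈ S)
    (A B : FreeMonoid X) :
    word k (A * σ.1 * B) - relator A σ B ∈ wordsBelow k lt (A * σ.1 * B) := by
  convert h.mul_mem_wordsBelow (h.compatible σ hσ) A B using 1
  simp only [relator, map_mul]; noncomm_ring

/-- One chosen relator for each reducible word spans the ideal, and it has coefficient 1 at that
word. In a nontrivial combination a maximal word of the support survives, whereas an irreducible
combination has coefficient zero at every reducible word. -/
theorem relators_disjoint_irreducibleSpan (h : IsCompatibleOrder S lt)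
    (hS : ResolvableRelative S lt) : Disjoint (relators S) (irreducibleSpan S) := by
  classical
  let Red := {w : FreeMonoid X // ∃ A B, ∃ σ ∈ S, w = A * σ.1 * B}
  choose A B σ hσ hw using fun w : Red => w.2
  let e : Red → FreeAlgebra k X := fun w => relator (A w) (σ w) (B w)
  -- Well-founded induction on the leading word: any relator at `w` differs from the chosen one by
  -- relators at smaller words.
  have hsub : ∀ w : FreeMonoid X, ∀ A' B', ∀ τ ∈ S, w = A' * τ.1 * B' →
      relator A' τ B' ∈ Submodule.span k (Set.range e) := by
    intro w
    induction w using h.descendingChain.induction with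
    | _ w ih =>
      intro A' B' τ hτ hwτ
      let v : Red := ⟨w, A', B', τ, hτ, hwτ⟩
      have h1 := h.relator_sub_mem hS hτ (hσ v) (hwτ.symm.trans (hw v))
      have h2 : relatorsBelow S lt (A' * τ.1 * B') ≤ Submodule.span k (Set.range e) := by
        refine Submodule.span_le.2 ?_
        rintro _ ⟨A₁, B₁, σ₁, hσ₁, hlt, rfl⟩
        exact ih _ (hwτ ▸ hlt) A₁ B₁ σ₁ hσ₁ rfl
      have h3 : e v ∈ Submodule.span k (Set.range e) := Submodule.subset_span ⟨v, rfl⟩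
      have := add_mem (h2 h1) h3
      simpa [e] using this
  have hle : relators S ≤ Submodule.span k (Set.range e) := by
    refine Submodule.span_le.2 ?_
    rintro _ ⟨A', B', τ, hτ, rfl⟩
    exact hsub _ A' B' τ hτ rfl
  let b := FreeAlgebra.basisFreeMonoid k X
  have hbelow : ∀ (w : FreeMonoid X), ∀ x ∈ wordsBelow k lt w, ∀ v, ¬ lt v w →
      b.repr x v = 0 := by
    intro w x hx v hv
    induction hx using Submodule.span_induction with
    | zero => simp
    | add x y _ _ hx hy => simp [hx, hy]
    | smul c x _ hx => simp [hx]
    | mem x hx =>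
      obtain ⟨u, hu, rfl⟩ := hx
      rw [show b.repr (word k u) = _ from repr_word u, Finsupp.single_apply, if_neg]
      rintro rfl
      exact hv hu
  have he : ∀ (u : Red) (v : FreeMonoid X), ¬ lt v u.1 →
      b.repr (e u) v = if u.1 = v then 1 else 0 := by
    intro u v huv
    have h1 := h.relator_sub_word_mem (hσ u) (A u) (B u)
    rw [← hw u] at h1
    have h2 := hbelow _ _ h1 v huv
    rw [map_sub, Finsupp.sub_apply, show b.repr (word k u.1) = _ from repr_word u.1,
      Finsupp.single_apply, sub_eq_zero] at h2
    exact h2.symm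
  have hirr : ∀ x ∈ irreducibleSpan S, ∀ u : Red, b.repr x u.1 = 0 := by
    intro x hx u
    induction hx using Submodule.span_induction with
    | zero => simp
    | add x y _ _ hx hy => simp [hx, hy]
    | smul c x _ hx => simp [hx]
    | mem x hx =>
      obtain ⟨v, hv, rfl⟩ := hx
      rw [show b.repr (word k v) = _ from repr_word v, Finsupp.single_apply, if_neg]
      rintro rfl
      exact hv _ (hσ u) _ _ (hw u)
  rw [Submodule.disjoint_def]
  intro x hx hx'
  obtain ⟨c, rfl⟩ := (Finsupp.mem_span_range_iff_exists_finsupp).1 (hle hx)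
  by_contra hne
  have hsupp : c.support.Nonempty := by
    rw [Finset.nonempty_iff_ne_empty]
    intro h0
    rw [Finsupp.support_eq_empty] at h0
    exact hne (by simp [h0])
  -- The order is only partial and need not have maximal elements globally. Reversed and restricted
  -- to the finite support it is well-founded, which yields a maximal word `m`.
  have hwf : WellFounded fun u v : Red => lt v.1 u.1 ∧ v ∈ c.support ∧ u ∈ c.support := by
    have htr : IsTrans Red fun u v => lt v.1 u.1 ∧ v ∈ c.support ∧ u ∈ c.support :=
      ⟨fun a b d hab hbd => ⟨h.trans hbd.1 hab.1, hbd.2.1, hab.2.2⟩⟩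
    have hir : Std.Irrefl fun u v : Red => lt v.1 u.1 ∧ v ∈ c.support ∧ u ∈ c.support :=
      ⟨fun a ha => h.irrefl _ ha.1⟩
    have : IsStrictOrder Red fun u v => lt v.1 u.1 ∧ v ∈ c.support ∧ u ∈ c.support :=
      { toIrrefl := hir, toIsTrans := htr }
    have := (c.support.finite_toSet).wellFoundedOn
      (r := fun u v : Red => lt v.1 u.1 ∧ v ∈ c.support ∧ u ∈ c.support)
    refine (Set.wellFoundedOn_iff.1 this).mono ?_
    intro u v huv
    exact ⟨huv, huv.2.2, huv.2.1⟩
  obtain ⟨m, hm, hmax⟩ := hwf.has_min (c.support : Set Red) hsupp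
  have hm0 := hirr _ hx' m
  rw [Finsupp.sum, map_sum, Finsupp.finsetSum_apply, Finset.sum_eq_single_of_mem m hm] at hm0
  · rw [map_smul, Finsupp.smul_apply, he m m.1 (h.irrefl _)] at hm0
    simp at hm0
    exact (Finsupp.mem_support_iff.1 hm) hm0
  · intro u hu hum
    rw [map_smul, Finsupp.smul_apply, he u m.1, if_neg, smul_zero]
    · exact fun e => hum (Subtype.ext e)
    · exact fun hlt => hmax u hu ⟨hlt, hm, hu⟩

/-! ### Reductions, normal forms and the resulting basis -/

theorem reduction_irreducible {σ : Rule k X} (hσ : σ ∈ S) (A B : FreeMonoid X)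
    {x : FreeAlgebra k X} (hx : x ∈ irreducibleSpan S) : reduction A σ B x = x := by
  induction hx using Submodule.span_induction with
  | zero => simp
  | add x y _ _ hx hy => rw [map_add, hx, hy]
  | smul c x _ hx => rw [map_smul, hx]
  | mem x hx =>
    obtain ⟨v, hv, rfl⟩ := hx
    rw [reduction_word, if_neg (hv σ hσ A B)]

theorem reductionMonoid_irreducible {ρ : Module.End k (FreeAlgebra k X)}
    (hρ : ρ ∈ reductionMonoid S) {x : FreeAlgebra k X} (hx : x ∈ irreducibleSpan S) :
    ρ x = x := by
  induction hρ using Submonoid.closure_induction with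
  | one => rfl
  | mem ρ h =>
    obtain ⟨A, B, σ, hσ, rfl⟩ := h
    exact reduction_irreducible hσ A B hx
  | mul ρ ρ' _ _ h h' => rw [Module.End.mul_apply, h', h]

theorem reduction_sub_mem {σ : Rule k X} (hσ : σ ∈ S) (A B : FreeMonoid X)
    (x : FreeAlgebra k X) : reduction A σ B x - x ∈ relators S := by
  have hx : x ∈ Submodule.span k (Set.range (word k (X := X))) := by simp [span_range_word]
  induction hx using Submodule.span_induction with
  | zero => simp
  | add x y _ _ hx hy =>
    rw [map_add, add_sub_add_comm]; exact add_mem hx hy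
  | smul c x _ hx => rw [map_smul, ← smul_sub]; exact Submodule.smul_mem _ _ hx
  | mem x hx =>
    obtain ⟨v, rfl⟩ := hx
    rw [reduction_word]
    split_ifs with hv
    · have := Submodule.neg_mem _ (mul_mem_relators (rule_mem_relators hσ) (word k A) (word k B))
      convert this using 1
      rw [hv]
      simp only [map_mul]; noncomm_ring
    · simp

theorem reductionMonoid_sub_mem {ρ : Module.End k (FreeAlgebra k X)}
    (hρ : ρ ∈ reductionMonoid S) (x : FreeAlgebra k X) : ρ x - x ∈ relators S := by
  induction hρ using Submonoid.closure_induction generalizing x with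
  | one => simp
  | mem ρ h =>
    obtain ⟨A, B, σ, hσ, rfl⟩ := h
    exact reduction_sub_mem hσ A B x
  | mul ρ ρ' _ _ h h' =>
    have := add_mem (h (ρ' x)) (h' x)
    rwa [sub_add_sub_cancel] at this

theorem reduction_mem_wordsBelow (h : IsCompatibleOrder S lt) {σ : Rule k X} (hσ : σ ∈ S)
    (A B : FreeMonoid X) {w : FreeMonoid X} {x : FreeAlgebra k X}
    (hx : x ∈ wordsBelow k lt w) : reduction A σ B x ∈ wordsBelow k lt w := by
  induction hx using Submodule.span_induction with
  | zero => simp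
  | add x y _ _ hx hy => rw [map_add]; exact add_mem hx hy
  | smul c x _ hx => rw [map_smul]; exact Submodule.smul_mem _ _ hx
  | mem x hx =>
    obtain ⟨v, hv, rfl⟩ := hx
    rw [reduction_word]
    split_ifs with he
    · refine h.wordsBelow_mono hv ?_
      rw [he]
      exact h.mul_mem_wordsBelow (h.compatible σ hσ) A B
    · exact Submodule.subset_span ⟨v, hv, rfl⟩

/-- The first conjunct makes the second one stable under composition: once a word has dropped below
itself, it stays below. -/
theorem reductionMonoid_word (h : IsCompatibleOrder S lt) {ρ : Module.End k (FreeAlgebra k X)}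
    (hρ : ρ ∈ reductionMonoid S) (w : FreeMonoid X) :
    (∀ x ∈ wordsBelow k lt w, ρ x ∈ wordsBelow k lt w) ∧
      (ρ (word k w) = word k w ∨ ρ (word k w) ∈ wordsBelow k lt w) := by
  induction hρ using Submonoid.closure_induction with
  | one => exact ⟨fun _ hx => hx, Or.inl rfl⟩
  | mem ρ hρ =>
    obtain ⟨A, B, σ, hσ, rfl⟩ := hρ
    refine ⟨fun x hx => h.reduction_mem_wordsBelow hσ A B hx, ?_⟩
    rw [reduction_word]
    split_ifs with he
    · rw [he]
      exact Or.inr (h.mul_mem_wordsBelow (h.compatible σ hσ) A B)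
    · exact Or.inl rfl
  | mul ρ ρ' _ _ hρ hρ' =>
    refine ⟨fun x hx => hρ.1 _ (hρ'.1 x hx), ?_⟩
    rw [Module.End.mul_apply]
    rcases hρ'.2 with h1 | h1
    · rw [h1]; exact hρ.2
    · exact Or.inr (hρ.1 _ h1)

/-- The elements all of whose reducts can be reduced to irreducible elements. -/
def reductionFinite (S : Set (Rule k X)) : Submodule k (FreeAlgebra k X) where
  carrier := {x | ∀ ρ ∈ reductionMonoid S, ∃ ρ' ∈ reductionMonoid S,
    ρ' (ρ x) ∈ irreducibleSpan S}
  zero_mem' := fun ρ hρ => ⟨1, one_mem _, by simp⟩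
  -- The reduct of `x` is made irreducible first and that of `y` afterwards; the second composite
  -- fixes what is already irreducible.
  add_mem' := by
    intro x y hx hy ρ hρ
    obtain ⟨ρ₁, hρ₁, h1⟩ := hx ρ hρ
    obtain ⟨ρ₂, hρ₂, h2⟩ := hy (ρ₁ * ρ) (mul_mem hρ₁ hρ)
    refine ⟨ρ₂ * ρ₁, mul_mem hρ₂ hρ₁, ?_⟩
    rw [map_add, map_add]
    refine add_mem ?_ h2
    rw [Module.End.mul_apply, reductionMonoid_irreducible hρ₂ h1]
    exact h1
  smul_mem' := by
    intro c x hx ρ hρ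
    obtain ⟨ρ₁, hρ₁, h1⟩ := hx ρ hρ
    exact ⟨ρ₁, hρ₁, by rw [map_smul, map_smul]; exact Submodule.smul_mem _ _ h1⟩

theorem word_mem_reductionFinite (h : IsCompatibleOrder S lt) (w : FreeMonoid X) :
    word k w ∈ reductionFinite S := by
  induction w using h.descendingChain.induction with
  | _ w ih =>
    have hle : wordsBelow k lt w ≤ reductionFinite S := by
      refine Submodule.span_le.2 ?_
      rintro _ ⟨v, hv, rfl⟩
      exact ih v hv
    intro ρ hρ
    rcases (h.reductionMonoid_word hρ w).2 with h1 | h1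
    · rw [h1]
      by_cases hw : w ∈ irreducibleWords S
      · exact ⟨1, one_mem _, Submodule.subset_span ⟨w, hw, rfl⟩⟩
      · simp only [irreducibleWords, Set.mem_ofPred_eq, not_forall, not_not] at hw
        obtain ⟨σ, hσ, A, B, rfl⟩ := hw
        have h2 : reduction A σ B (word k (A * σ.1 * B)) ∈ reductionFinite S := by
          rw [reduction_word, if_pos rfl]
          exact hle (h.mul_mem_wordsBelow (h.compatible σ hσ) A B)
        obtain ⟨ρ', hρ', h3⟩ := h2 1 (one_mem _)
        exact ⟨ρ' * reduction A σ B,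
          mul_mem hρ' (Submonoid.subset_closure ⟨A, B, σ, hσ, rfl⟩), h3⟩
    · obtain ⟨ρ', hρ', h3⟩ := hle h1 1 (one_mem _)
      exact ⟨ρ', hρ', h3⟩

theorem exists_reduction_irreducible (h : IsCompatibleOrder S lt) (x : FreeAlgebra k X) :
    ∃ ρ ∈ reductionMonoid S, ρ x ∈ irreducibleSpan S := by
  have hx : x ∈ reductionFinite S := by
    have hle : Submodule.span k (Set.range (word k (X := X))) ≤ reductionFinite S := by
      refine Submodule.span_le.2 ?_
      rintro _ ⟨w, rfl⟩
      exact h.word_mem_reductionFinite w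
    rw [span_range_word] at hle
    exact hle Submodule.mem_top
  exact hx 1 (one_mem _)

/-- Reducing both elements to irreducible ones changes neither class modulo the ideal, so the two
results differ by an irreducible element of the ideal, which is zero. -/
theorem joinable_of_sub_mem (h : IsCompatibleOrder S lt) (hS : ResolvableRelative S lt)
    {f g : FreeAlgebra k X} (hfg : f - g ∈ relators S) : Joinable S f g := by
  obtain ⟨ρ, hρ, h1⟩ := h.exists_reduction_irreducible f
  obtain ⟨ρ', hρ', h2⟩ := h.exists_reduction_irreducible g
  refine ⟨ρ, hρ, ρ', hρ', sub_eq_zero.1 ?_⟩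
  refine Submodule.disjoint_def.1 (h.relators_disjoint_irreducibleSpan hS) _ ?_ (sub_mem h1 h2)
  have h3 := sub_mem (add_mem (reductionMonoid_sub_mem hρ f) hfg) (reductionMonoid_sub_mem hρ' g)
  convert h3 using 1
  abel

/-- Relative resolvability of the ambiguities implies their resolvability. -/
theorem diamondLemmaApplicable (h : IsCompatibleOrder S lt) (hS : ResolvableRelative S lt) :
    DiamondLemmaApplicable S := by
  refine ⟨⟨lt, h⟩, ?_, ?_⟩
  · intro σ hσ τ hτ A B C _ _ _ h1 h2
    refine h.joinable_of_sub_mem hS ?_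
    have h3 := sub_mem (mul_mem_relators (rule_mem_relators hτ) (word k A) 1)
      (mul_mem_relators (rule_mem_relators hσ) 1 (word k C))
    convert h3 using 1
    rw [h1, h2]
    simp only [map_mul]
    noncomm_ring
  · intro σ hσ τ hτ _ A C h1
    refine h.joinable_of_sub_mem hS ?_
    have h3 := sub_mem (rule_mem_relators hτ)
      (mul_mem_relators (rule_mem_relators hσ) (word k A) (word k C))
    convert h3 using 1
    rw [h1]
    simp only [map_mul]
    noncomm_ring

/-- Independence is the disjointness of the kernel from the irreducible span; generation is the
existence of normal forms. -/
theorem basis_of_ker (h : IsCompatibleOrder S lt) (hS : ResolvableRelative S lt)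
    {H : Type*} [Ring H] [Algebra k H] (π : FreeAlgebra k X →ₐ[k] H)
    (hsurj : Function.Surjective π) (hker : ∀ x, π x = 0 ↔ x ∈ relators S) :
    IrreducibleWordsFormBasis S π := by
  have hli : LinearIndependent k
      (fun w : irreducibleWords S => π.toLinearMap (word k (w : FreeMonoid X))) := by
    refine LinearIndependent.map (v := fun w : irreducibleWords S => word k (w : FreeMonoid X))
      (linearIndependent_word.comp _ Subtype.val_injective) ?_
    have : Set.range (fun w : irreducibleWords S => word k (w : FreeMonoid X)) =
        word k '' irreducibleWords S := by
      ext x; simp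
    rw [this]
    have hk : LinearMap.ker π.toLinearMap = relators S := by
      ext x; simp [hker]
    rw [hk]
    exact (h.relators_disjoint_irreducibleSpan hS).symm
  refine ⟨Module.Basis.mk hli ?_, fun w => by simp⟩
  intro y _
  obtain ⟨x, rfl⟩ := hsurj y
  obtain ⟨ρ, hρ, h1⟩ := h.exists_reduction_irreducible x
  have h2 : π x = π (ρ x) := by
    have := (hker _).2 (reductionMonoid_sub_mem hρ x)
    rw [map_sub, sub_eq_zero] at this
    exact this.symm
  rw [h2]
  have h3 : irreducibleSpan S ≤ (Submodule.span k (Set.range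
      fun w : irreducibleWords S => π.toLinearMap (word k (w : FreeMonoid X)))).comap
      π.toLinearMap := by
    refine Submodule.span_le.2 ?_
    rintro _ ⟨w, hw, rfl⟩
    exact Submodule.subset_span ⟨⟨w, hw⟩, rfl⟩
  exact h3 h1

end IsCompatibleOrder

/-- Equality in the quotient is the equivalence relation generated by the ring closure of `r`, and
the span `relators S` absorbs multiplication on both sides. -/
theorem mkAlgHom_eq_zero_iff (r : FreeAlgebra k X → FreeAlgebra k X → Prop)
    (hr : ∀ a b, r a b → a - b ∈ relators S)
    (hS : ∀ σ ∈ S, RingQuot.mkAlgHom k r (word k σ.1) = RingQuot.mkAlgHom k r σ.2)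
    (x : FreeAlgebra k X) : RingQuot.mkAlgHom k r x = 0 ↔ x ∈ relators S := by
  have hrel : ∀ a b, RingQuot.Rel r a b → a - b ∈ relators S := by
    intro a b hab
    induction hab with
    | of h => exact hr _ _ h
    | add_left _ ih => simpa using ih
    | mul_left _ ih =>
      rw [← sub_mul]
      simpa using mul_mem_relators ih 1 _
    | mul_right _ ih =>
      rw [← mul_sub]
      simpa using mul_mem_relators ih _ 1
  constructor
  · intro hx
    have h1 : RingQuot.mkRingHom r x = RingQuot.mkRingHom r 0 := by
      rw [← RingQuot.mkAlgHom_coe k r, map_zero]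
      exact hx
    simp only [RingQuot.mkRingHom_def] at h1
    have h2 : Quot.mk (RingQuot.Rel r) x = Quot.mk (RingQuot.Rel r) 0 := by
      simpa using h1
    have h3 := Quot.eqvGen_exact h2
    have h4 : ∀ a b, Relation.EqvGen (RingQuot.Rel r) a b → a - b ∈ relators S := by
      intro a b hab
      induction hab with
      | rel a b h => exact hrel a b h
      | refl a => simp
      | symm a b _ ih => simpa using neg_mem ih
      | trans a b c _ _ h1 h2 => simpa using add_mem h1 h2
    simpa using h4 _ _ h3
  · intro hx
    induction hx using Submodule.span_induction with
    | zero => simp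
    | add x y _ _ hx hy => simp [hx, hy]
    | smul c x _ hx => simp [hx]
    | mem x hx =>
      obtain ⟨A, B, σ, hσ, rfl⟩ := hx
      simp [relator, hS σ hσ]

end DiamondLemma

/-! ### The order on words -/

section WordOrder

variable {R : Type*} {n : ℕ} (par : R → Bool)

/-- The weight of the row index of a letter: increasing for even `r`, decreasing for odd `r`. -/
def rowKey (x : Gen R n) : ℕ := if par x.1 then x.2.1 else n - x.2.1

/-- The weight of the column index of a letter: decreasing for even `r`, increasing for odd `r`. -/
def colKey (x : Gen R n) : ℕ := if par x.1 then n - x.2.2 else x.2.2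

/-- The row weights of a word, and its column weights read from the right. -/
def wordKey (w : FreeMonoid (Gen R n)) : List ℕ × List ℕ :=
  (w.toList.map (rowKey par), (w.toList.map (colKey par)).reverse)

/-- Compare words by length, then by row weights from the left, then by column weights from the
right. -/
def wordLt : FreeMonoid (Gen R n) → FreeMonoid (Gen R n) → Prop :=
  InvImage (Prod.Lex (List.Shortlex (· < ·)) (List.Shortlex (· < ·))) (wordKey par)

theorem wordLt_iff (v w : FreeMonoid (Gen R n)) : wordLt par v w ↔
    List.Shortlex (· < ·) (v.toList.map (rowKey par)) (w.toList.map (rowKey par)) ∨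
      (v.toList.map (rowKey par) = w.toList.map (rowKey par) ∧
        List.Shortlex (· < ·) (v.toList.map (colKey par)).reverse
          (w.toList.map (colKey par)).reverse) := by
  rw [wordLt, InvImage, Prod.lex_def]
  rfl

theorem wordLt_wellFounded : WellFounded (wordLt par (n := n)) :=
  InvImage.wf _ ((List.Shortlex.wf wellFounded_lt).prod_lex (List.Shortlex.wf wellFounded_lt))

theorem shortlex_trans {a b c : List ℕ} (hab : List.Shortlex (· < ·) a b)
    (hbc : List.Shortlex (· < ·) b c) : List.Shortlex (· < ·) a c := by
  rw [List.shortlex_def] at *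
  rcases hab with hab | ⟨h1, hab⟩ <;> rcases hbc with hbc | ⟨h2, hbc⟩
  · left; lia
  · left; lia
  · left; lia
  · exact Or.inr ⟨h1.trans h2, List.lt_trans (α := ℕ) hab hbc⟩

/-- Appending on the right is harmless because lexicographic comparison is only used between lists
of equal length, where it is decided before either list ends. -/
theorem shortlex_append {a b : List ℕ} (h : List.Shortlex (· < ·) a b) (l m : List ℕ) :
    List.Shortlex (· < ·) (l ++ a ++ m) (l ++ b ++ m) := by
  rw [List.append_assoc, List.append_assoc]
  refine List.Shortlex.append_left ?_ l
  rw [List.shortlex_def] at *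
  rcases h with h | ⟨h1, h⟩
  · left; simpa using h
  · refine Or.inr ⟨by simpa using h1, ?_⟩
    induction a generalizing b with
    | nil => cases b with
      | nil => simp at h
      | cons => simp at h1
    | cons x a ih => cases b with
      | nil => simp at h1
      | cons y b =>
        rw [List.cons_lex_cons_iff] at h
        rw [List.cons_append, List.cons_append, List.cons_lex_cons_iff]
        exact h.imp id fun h2 => ⟨h2.1, ih (by simpa using h1) h2.2⟩

theorem wordLt_isStrictOrder : IsStrictOrder _ (wordLt par (n := n)) where
  irrefl := (wordLt_wellFounded par).irrefl.irrefl
  trans a b c hab hbc := by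
    rw [wordLt_iff] at *
    rcases hab with hab | ⟨h1, hab⟩ <;> rcases hbc with hbc | ⟨h2, hbc⟩
    · exact Or.inl (shortlex_trans hab hbc)
    · exact Or.inl (h2 ▸ hab)
    · exact Or.inl (h1 ▸ hbc)
    · exact Or.inr ⟨h1.trans h2, shortlex_trans hab hbc⟩

theorem wordLt_semigroup (A C B B' : FreeMonoid (Gen R n)) (h : wordLt par B B') :
    wordLt par (A * B * C) (A * B' * C) := by
  rw [wordLt_iff] at *
  simp only [FreeMonoid.toList_mul, List.map_append, List.reverse_append]
  rcases h with h | ⟨h1, h⟩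
  · exact Or.inl (shortlex_append h _ _)
  · refine Or.inr ⟨by rw [h1], ?_⟩
    rw [← List.append_assoc, ← List.append_assoc]
    exact shortlex_append h _ _

theorem wordLt_pair_iff (a b a' b' : Gen R n) :
    wordLt par (FreeMonoid.of a * FreeMonoid.of b) (FreeMonoid.of a' * FreeMonoid.of b') ↔
      rowKey par a < rowKey par a' ∨ rowKey par a = rowKey par a' ∧
      (rowKey par b < rowKey par b' ∨ rowKey par b = rowKey par b' ∧
      (colKey par b < colKey par b' ∨ colKey par b = colKey par b' ∧
        colKey par a < colKey par a')) := by
  rw [wordLt_iff]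
  simp [List.shortlex_def, List.cons_lex_cons_iff]
  tauto

theorem wordLt_triple_iff (a b c a' b' c' : Gen R n) :
    wordLt par (FreeMonoid.of a * (FreeMonoid.of b * FreeMonoid.of c))
      (FreeMonoid.of a' * (FreeMonoid.of b' * FreeMonoid.of c')) ↔
      rowKey par a < rowKey par a' ∨ rowKey par a = rowKey par a' ∧
      (rowKey par b < rowKey par b' ∨ rowKey par b = rowKey par b' ∧
      (rowKey par c < rowKey par c' ∨ rowKey par c = rowKey par c' ∧
      (colKey par c < colKey par c' ∨ colKey par c = colKey par c' ∧
      (colKey par b < colKey par b' ∨ colKey par b = colKey par b' ∧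
        colKey par a < colKey par a')))) := by
  rw [wordLt_iff]
  simp [List.shortlex_def, List.cons_lex_cons_iff]
  tauto

theorem wordLt_one_pair (a b : Gen R n) :
    wordLt par 1 (FreeMonoid.of a * FreeMonoid.of b) := by
  rw [wordLt_iff]
  exact Or.inl (List.Shortlex.of_length_lt (by simp))

end WordOrder

/-! ### Matrices of relators and the identities between them -/

section Relators

open Matrix

variable (k : Type*) [Field k] {n : ℕ} {R : Type*}

/-- The matrix of the elements `∑ₐ x^r_{ia} x^s_{ja} - δ_{ij}`. -/
def relP (r s : R) : Matrix (Fin n) (Fin n) (FreeGen k R n) :=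
  genMatrix k n r * (genMatrix k n s)ᵀ - 1

/-- The matrix of the elements `∑ₐ x^s_{ai} x^r_{aj} - δ_{ij}`. -/
def relQ (r s : R) : Matrix (Fin n) (Fin n) (FreeGen k R n) :=
  (genMatrix k n s)ᵀ * genMatrix k n r - 1

variable {k}

/-- A scalar matrix regarded as a matrix over the free algebra. -/
def scalarMatrix (R : Type*) (M : Matrix (Fin n) (Fin n) k) :
    Matrix (Fin n) (Fin n) (FreeGen k R n) :=
  M.map (algebraMap k _)

theorem scalarMatrix_mul (M N : Matrix (Fin n) (Fin n) k) :
    scalarMatrix R M * scalarMatrix R N = scalarMatrix R (M * N) := by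
  simp [scalarMatrix, Matrix.map_mul]

theorem scalarMatrix_one : scalarMatrix R (1 : Matrix (Fin n) (Fin n) k) = 1 := by
  simp [scalarMatrix]

/-- The matrix `F (X^s)ᵗ F⁻¹`. -/
def twisted (s : R) (F : GL (Fin n) k) : Matrix (Fin n) (Fin n) (FreeGen k R n) :=
  scalarMatrix R (F : Matrix (Fin n) (Fin n) k) * (genMatrix k n s)ᵀ *
    scalarMatrix R ((F⁻¹ : GL (Fin n) k) : Matrix (Fin n) (Fin n) k)

/-- The matrix `X^r F (X^s)ᵗ F⁻¹ - 1`. -/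
def relT (r s : R) (F : GL (Fin n) k) : Matrix (Fin n) (Fin n) (FreeGen k R n) :=
  genMatrix k n r * twisted s F - 1

/-- The matrix `F (X^s)ᵗ F⁻¹ X^r - 1`. -/
def relU (r s : R) (F : GL (Fin n) k) : Matrix (Fin n) (Fin n) (FreeGen k R n) :=
  twisted s F * genMatrix k n r - 1

/-- Both sides are `X Yᵗ X - X`; the entries of this identity settle the overlap of `red1` with
`red4`. -/
theorem relP_mul (r s : R) :
    relP k r s * genMatrix k n r = genMatrix k n r * relQ k r s := by
  simp only [relP, relQ]; noncomm_ring

theorem relQ_mul (r s : R) :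
    relQ k r s * (genMatrix k n s)ᵀ = (genMatrix k n s)ᵀ * relP k r s := by
  simp only [relP, relQ]; noncomm_ring

theorem relT_mul (r s : R) (F : GL (Fin n) k) :
    relT r s F * genMatrix k n r = genMatrix k n r * relU r s F := by
  simp only [relT, relU]; noncomm_ring

theorem scalarMatrix_inv_mul_coe (F : GL (Fin n) k) :
    scalarMatrix R ((F⁻¹ : GL (Fin n) k) : Matrix (Fin n) (Fin n) k) *
      scalarMatrix R (F : Matrix (Fin n) (Fin n) k) = 1 := by
  rw [scalarMatrix_mul, ← Units.val_mul, inv_mul_cancel, Units.val_one, scalarMatrix_one]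

/-- Both sides equal `Xᵗ F⁻¹ Y F Xᵗ - Xᵗ` for `X = X^s`, `Y = X^r`. Conjugating by `F` replaces the
outer factor `F Xᵗ F⁻¹` of `U G = G T` by the bare `Xᵗ`, whose entries are letters. -/
theorem relU_conj (r s : R) (F : GL (Fin n) k) :
    scalarMatrix R ((F⁻¹ : GL (Fin n) k) : Matrix (Fin n) (Fin n) k) * relU r s F *
        scalarMatrix R (F : Matrix (Fin n) (Fin n) k) * (genMatrix k n s)ᵀ =
      (genMatrix k n s)ᵀ *
        (scalarMatrix R ((F⁻¹ : GL (Fin n) k) : Matrix (Fin n) (Fin n) k) * relT r s F *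
          scalarMatrix R (F : Matrix (Fin n) (Fin n) k)) := by
  have h := scalarMatrix_inv_mul_coe (R := R) F
  simp only [relT, relU, twisted]
  generalize scalarMatrix R (F : Matrix (Fin n) (Fin n) k) = f at *
  generalize scalarMatrix R ((F⁻¹ : GL (Fin n) k) : Matrix (Fin n) (Fin n) k) = g at *
  generalize (genMatrix k n s)ᵀ = x
  generalize genMatrix k n r = y
  have h1 : g * (f * x * g * y - 1) * f * x = (g * f) * (x * g * y * f * x) - (g * f) * x := by
    noncomm_ring
  have h2 : x * (g * (y * (f * x * g) - 1) * f) =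
      x * g * y * f * x * (g * f) - x * (g * f) := by
    noncomm_ring
  rw [h1, h2, h]
  simp

theorem kron_eq (i j : Fin n) : kron k n i j = (1 : Matrix (Fin n) (Fin n) (FreeGen k R n)) i j := by
  simp [kron, Matrix.one_apply]

theorem relP_apply (r s : R) (i j : Fin n) : relP k r s i j =
    ∑ a, genMatrix k n r i a * genMatrix k n s j a - kron k n i j := by
  simp [relP, kron_eq, Matrix.mul_apply]

theorem relQ_apply (r s : R) (i j : Fin n) : relQ k r s i j =
    ∑ a, genMatrix k n s a i * genMatrix k n r a j - kron k n i j := by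
  simp [relQ, kron_eq, Matrix.mul_apply]

theorem relT_apply (r s : R) (F : GL (Fin n) k) (i j : Fin n) : relT r s F i j =
    ∑ t : Fin n × Fin n × Fin n, (F t.1 t.2.1 * (F⁻¹ : GL (Fin n) k) t.2.2 j) •
      (genMatrix k n r i t.1 * genMatrix k n s t.2.2 t.2.1) - kron k n i j := by
  simp only [relT, twisted, scalarMatrix, Matrix.sub_apply, kron_eq, Matrix.mul_apply,
    Matrix.map_apply, Matrix.transpose_apply, Fintype.sum_prod_type, Finset.sum_mul,
    Finset.mul_sum]
  congr 1
  refine Finset.sum_congr rfl fun l _ => ?_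
  rw [Finset.sum_comm]
  refine Finset.sum_congr rfl fun p _ => Finset.sum_congr rfl fun u _ => ?_
  rw [← Algebra.commutes, Algebra.algebraMap_eq_smul_one, Algebra.algebraMap_eq_smul_one]
  simp [smul_smul, mul_comm]

theorem relU_apply (r s : R) (F : GL (Fin n) k) (i j : Fin n) : relU r s F i j =
    ∑ t : Fin n × Fin n × Fin n, (F i t.1 * (F⁻¹ : GL (Fin n) k) t.2.1 t.2.2) •
      (genMatrix k n s t.2.1 t.1 * genMatrix k n r t.2.2 j) - kron k n i j := by
  simp only [relU, twisted, scalarMatrix, Matrix.sub_apply, kron_eq, Matrix.mul_apply,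
    Matrix.map_apply, Matrix.transpose_apply, Fintype.sum_prod_type, Finset.sum_mul]
  congr 1
  refine (Finset.sum_congr rfl fun l _ => Finset.sum_comm).trans ?_
  rw [Finset.sum_comm]
  refine Finset.sum_congr rfl fun p _ => ?_
  rw [Finset.sum_comm]
  refine Finset.sum_congr rfl fun u _ => Finset.sum_congr rfl fun l _ => ?_
  rw [← Algebra.commutes, Algebra.algebraMap_eq_smul_one, Algebra.algebraMap_eq_smul_one]
  simp [smul_smul, mul_comm]

/-- Both sides are the trace of `F⁻¹ U`, that is of `(X^r)ᵗ F⁻¹ X^s - F⁻¹`. This relates the two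
rules that share a left-hand side when `d = 1`. -/
theorem sum_smul_relP (r s : R) (F : GL (Fin n) k) :
    ∑ t : Fin n × Fin n, (F⁻¹ : GL (Fin n) k) t.1 t.2 • relP k r s t.1 t.2 =
      ∑ t : Fin n × Fin n, (F⁻¹ : GL (Fin n) k) t.2 t.1 • relU s r F t.1 t.2 := by
  have h1 : scalarMatrix R ((F⁻¹ : GL (Fin n) k) : Matrix (Fin n) (Fin n) k) * relU s r F =
      (genMatrix k n r)ᵀ * scalarMatrix R ((F⁻¹ : GL (Fin n) k) : Matrix (Fin n) (Fin n) k) *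
        genMatrix k n s -
          scalarMatrix R ((F⁻¹ : GL (Fin n) k) : Matrix (Fin n) (Fin n) k) := by
    have h := scalarMatrix_inv_mul_coe (R := R) F
    rw [relU, twisted, mul_sub, mul_one, ← mul_assoc, ← mul_assoc, ← mul_assoc, h, one_mul]
  have h2 := congrArg Matrix.trace h1
  simp only [Matrix.trace, Matrix.diag_apply, Matrix.sub_apply, Matrix.mul_apply,
    scalarMatrix, Matrix.map_apply, Matrix.transpose_apply] at h2
  have h3 : ∑ t : Fin n × Fin n, (F⁻¹ : GL (Fin n) k) t.2 t.1 • relU s r F t.1 t.2 =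
      ∑ j, ∑ i, algebraMap k (FreeGen k R n) ((F⁻¹ : GL (Fin n) k) j i) * relU s r F i j := by
    simp only [Fintype.sum_prod_type, Algebra.smul_def]
    rw [Finset.sum_comm]
  rw [h3, h2, Finset.sum_sub_distrib]
  simp only [relP_apply, kron, Fintype.sum_prod_type, smul_sub, Finset.sum_sub_distrib]
  congr 1
  · simp only [Finset.smul_sum, Finset.sum_mul]
    rw [Finset.sum_comm]
    refine (Finset.sum_congr rfl fun l _ => Finset.sum_comm).trans ?_
    rw [Finset.sum_comm]
    refine Finset.sum_congr rfl fun p _ => Finset.sum_congr rfl fun l _ =>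
      Finset.sum_congr rfl fun u _ => ?_
    rw [← Algebra.commutes, Algebra.smul_def, mul_assoc]
  · simp [Algebra.algebraMap_eq_smul_one]

/-- Both sides are the trace of `T F`, that is of `X^s F (X^r)ᵗ - F`. -/
theorem sum_smul_relQ (r s : R) (F : GL (Fin n) k) :
    ∑ t : Fin n × Fin n, F t.1 t.2 • relQ k r s t.1 t.2 =
      ∑ t : Fin n × Fin n, F t.2 t.1 • relT s r F t.1 t.2 := by
  have h1 : relT s r F * scalarMatrix R (F : Matrix (Fin n) (Fin n) k) =
      genMatrix k n s * scalarMatrix R (F : Matrix (Fin n) (Fin n) k) *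
        (genMatrix k n r)ᵀ - scalarMatrix R (F : Matrix (Fin n) (Fin n) k) := by
    have h := scalarMatrix_inv_mul_coe (R := R) F
    rw [relT, twisted, sub_mul, one_mul, mul_assoc, mul_assoc, h, mul_one, mul_assoc]
  have h2 := congrArg Matrix.trace h1
  simp only [Matrix.trace, Matrix.diag_apply, Matrix.sub_apply, Matrix.mul_apply,
    scalarMatrix, Matrix.map_apply, Matrix.transpose_apply] at h2
  have h3 : ∑ t : Fin n × Fin n, F t.2 t.1 • relT s r F t.1 t.2 =
      ∑ i, ∑ j, relT s r F i j * algebraMap k (FreeGen k R n) (F j i) := by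
    simp only [Fintype.sum_prod_type, Algebra.smul_def, Algebra.commutes]
  rw [h3, h2, Finset.sum_sub_distrib]
  simp only [relQ_apply, kron, Fintype.sum_prod_type, smul_sub, Finset.sum_sub_distrib]
  congr 1
  · simp only [Finset.smul_sum, Finset.sum_mul]
    refine (Finset.sum_congr rfl fun l _ => Finset.sum_comm).trans ?_
    rw [Finset.sum_comm]
    refine Finset.sum_congr rfl fun a _ => ?_
    rw [Finset.sum_comm]
    refine Finset.sum_congr rfl fun p _ => Finset.sum_congr rfl fun l _ => ?_
    rw [← Algebra.commutes, Algebra.smul_def, mul_assoc]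
  · simp [Algebra.algebraMap_eq_smul_one]

theorem word_pair (r s : R) (i j l m : Fin n) :
    word k (pair r i j s l m) = genMatrix k n r i j * genMatrix k n s l m := by
  simp [word, pair, genMatrix]

theorem sum_eq_add_filter {ι M : Type*} [Fintype ι] [DecidableEq ι] [AddCommMonoid M]
    (f : ι → M) (a : ι) (p : ι → Prop) [DecidablePred p] (hp : ∀ b, p b ↔ b ≠ a) :
    ∑ b, f b = f a + ∑ b with p b, f b := by
  rw [← Finset.add_sum_erase Finset.univ f (Finset.mem_univ a)]
  congr 2
  ext b
  simp [hp]

theorem inv_upper {F : GL (Fin n) k} (hF : ∀ i j : Fin n, j < i → F i j = 0) (i j : Fin n)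
    (hij : j < i) : (F⁻¹ : GL (Fin n) k) i j = 0 := by
  have h : Matrix.BlockTriangular (F : Matrix (Fin n) (Fin n) k) id := fun i j hij => hF i j hij
  have := F.invertible
  have h2 := Matrix.blockTriangular_inv_of_blockTriangular h hij
  rwa [← Matrix.coe_units_inv] at h2

theorem diag_mul_inv_diag {F : GL (Fin n) k} (hF : ∀ i j : Fin n, j < i → F i j = 0)
    (i : Fin n) : F i i * (F⁻¹ : GL (Fin n) k) i i = 1 := by
  have h : ((F : Matrix (Fin n) (Fin n) k) *
      ((F⁻¹ : GL (Fin n) k) : Matrix (Fin n) (Fin n) k)) i i = 1 := by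
    rw [← Units.val_mul, mul_inv_cancel]; simp
  rw [Matrix.mul_apply, Finset.sum_eq_single i] at h
  · exact h
  · intro b _ hb
    rcases lt_or_gt_of_ne hb with hb | hb
    · rw [hF i b hb, zero_mul]
    · rw [inv_upper hF b i hb, mul_zero]
  · simp

theorem diag_ne_zero {F : GL (Fin n) k} (hF : ∀ i j : Fin n, j < i → F i j = 0)
    (i : Fin n) : F i i ≠ 0 :=
  left_ne_zero_of_mul_eq_one (diag_mul_inv_diag hF i)

theorem inv_diag {F : GL (Fin n) k} (hF : ∀ i j : Fin n, j < i → F i j = 0)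
    (i : Fin n) : (F⁻¹ : GL (Fin n) k) i i = (F i i)⁻¹ :=
  eq_inv_of_mul_eq_one_right (diag_mul_inv_diag hF i)

theorem one_upper (i j : Fin n) (h : j < i) : (1 : GL (Fin n) k) i j = 0 := by
  simp [h.ne']

theorem relT_one (r s : R) : relT r s (1 : GL (Fin n) k) = relP k r s := by
  simp [relT, relP, twisted, scalarMatrix_one]

theorem relU_one (r s : R) : relU r s (1 : GL (Fin n) k) = relQ k r s := by
  simp [relU, relQ, twisted, scalarMatrix_one]

variable [NeZero n]

/-- The reduction `red5` at arbitrary superscripts `r` and `s`. -/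
def twistedRed5 (r s : R) (F : GL (Fin n) k) (i j : Fin n) : Rule k (Gen R n) :=
  (pair r i first s j first,
    ((F first first)⁻¹ * F j j) • (kron k n i j -
      ∑ t : Fin n × Fin n × Fin n with t ≠ (first, first, j),
        (F t.1 t.2.1 * (F⁻¹ : GL (Fin n) k) t.2.2 j) •
          (genMatrix k n r i t.1 * genMatrix k n s t.2.2 t.2.1)))

/-- The reduction `red6` at arbitrary superscripts `r` and `s`. -/
def twistedRed6 (r s : R) (F : GL (Fin n) k) (i j : Fin n) : Rule k (Gen R n) :=
  (pair s last i r last j,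
    ((F i i)⁻¹ * F last last) • (kron k n i j -
      ∑ t : Fin n × Fin n × Fin n with t ≠ (i, last, last),
        (F i t.1 * (F⁻¹ : GL (Fin n) k) t.2.1 t.2.2) •
          (genMatrix k n s t.2.1 t.1 * genMatrix k n r t.2.2 j)))

theorem lt_last_iff (a : Fin n) : a < last ↔ a ≠ last := by
  have := a.2
  simp only [last, Fin.lt_def, ne_eq, Fin.ext_iff]
  lia

theorem first_lt_iff (a : Fin n) : first < a ↔ a ≠ first := by
  simp only [first, Fin.lt_def, ne_eq, Fin.ext_iff]
  lia

theorem red1_sub (r s : R) (i j : Fin n) :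
    word k (red1 k r s i j).1 - (red1 k r s i j).2 = relP k r s i j := by
  rw [relP_apply, sum_eq_add_filter _ last _ lt_last_iff]
  simp only [red1, word_pair]
  abel

theorem red2_sub (r s : R) (i j : Fin n) :
    word k (red2 k r s i j).1 - (red2 k r s i j).2 = relP k r s i j := by
  rw [relP_apply, sum_eq_add_filter _ first _ first_lt_iff]
  simp only [red2, word_pair]
  abel

theorem red3_sub (r s : R) (i j : Fin n) :
    word k (red3 k r s i j).1 - (red3 k r s i j).2 = relQ k r s i j := by
  rw [relQ_apply, sum_eq_add_filter _ last _ lt_last_iff]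
  simp only [red3, word_pair]
  abel

theorem red4_sub (r s : R) (i j : Fin n) :
    word k (red4 k r s i j).1 - (red4 k r s i j).2 = relQ k r s i j := by
  rw [relQ_apply, sum_eq_add_filter _ first _ first_lt_iff]
  simp only [red4, word_pair]
  abel

/-- The leading monomial has coefficient `F₁₁ (F⁻¹)ⱼⱼ` in the entry of `T`, and triangularity gives
`(F⁻¹)ⱼⱼ = Fⱼⱼ⁻¹`, so the scalar in the rule normalises it to 1. -/
theorem twistedRed5_sub (r s : R) {F : GL (Fin n) k} (hF : ∀ i j : Fin n, j < i → F i j = 0)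
    (i j : Fin n) : word k (twistedRed5 r s F i j).1 - (twistedRed5 r s F i j).2 =
      ((F first first)⁻¹ * F j j) • relT r s F i j := by
  rw [relT_apply, sum_eq_add_filter _ (first, first, j) _ fun _ => Iff.rfl]
  have h1 := diag_ne_zero hF first
  have h2 := diag_ne_zero hF j
  simp only [twistedRed5, word_pair, inv_diag hF j]
  rw [add_sub_assoc, smul_add, smul_smul, ← neg_sub (kron k n i j), smul_neg, ← sub_eq_add_neg]
  congr 1
  rw [show (F first first)⁻¹ * F j j * (F first first * (F j j)⁻¹) = 1 by field_simp, one_smul]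

theorem twistedRed6_sub (r s : R) {F : GL (Fin n) k} (hF : ∀ i j : Fin n, j < i → F i j = 0)
    (i j : Fin n) : word k (twistedRed6 r s F i j).1 - (twistedRed6 r s F i j).2 =
      ((F i i)⁻¹ * F last last) • relU r s F i j := by
  rw [relU_apply, sum_eq_add_filter _ (i, last, last) _ fun _ => Iff.rfl]
  have h1 := diag_ne_zero hF i
  have h2 := diag_ne_zero hF last
  simp only [twistedRed6, word_pair, inv_diag hF last]
  rw [add_sub_assoc, smul_add, smul_smul, ← neg_sub (kron k n i j), smul_neg, ← sub_eq_add_neg]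
  congr 1
  rw [show (F i i)⁻¹ * F last last * (F i i * (F last last)⁻¹) = 1 by field_simp, one_smul]

/-- The left-hand words coincide and both relators are the same entry of `P`, so the right-hand
sides agree without expanding the sums. -/
theorem twistedRed5_one (r s : R) (i j : Fin n) :
    twistedRed5 r s (1 : GL (Fin n) k) i j = red2 k r s i j := by
  have h1 := twistedRed5_sub (k := k) r s one_upper i j
  have h2 := red2_sub (k := k) r s i j
  refine Prod.ext rfl ?_
  simp only [relT_one, Units.val_one, Matrix.one_apply_eq, inv_one, mul_one, one_smul] at h1
  exact sub_right_injective (h1.trans h2.symm)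

theorem twistedRed6_one (r s : R) (i j : Fin n) :
    twistedRed6 r s (1 : GL (Fin n) k) i j = red3 k r s i j := by
  have h1 := twistedRed6_sub (k := k) r s one_upper i j
  have h2 := red3_sub (k := k) r s i j
  refine Prod.ext rfl ?_
  simp only [relU_one, Units.val_one, Matrix.one_apply_eq, inv_one, mul_one, one_smul] at h1
  exact sub_right_injective (h1.trans h2.symm)

end Relators

/-! ### The common reduction system: compatibility and resolution of its ambiguities -/

section EdgeSystem

open FreeMonoid

variable {k : Type*} [Field k] {n : ℕ} {R : Type*} {par : R → Bool}

theorem kron_mem_wordsBelow (a b : Gen R n) (i j : Fin n) :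
    kron k n i j ∈ wordsBelow k (wordLt par) (of a * of b) := by
  rw [kron]
  split_ifs
  · exact Submodule.subset_span ⟨1, wordLt_one_pair par a b, by simp⟩
  · exact zero_mem _

theorem genMatrix_mul_mem_wordsBelow {r s : R} {i j l m : Fin n} {w : FreeMonoid (Gen R n)}
    (h : wordLt par (pair r i j s l m) w) :
    genMatrix k n r i j * genMatrix k n s l m ∈ wordsBelow k (wordLt par) w :=
  Submodule.subset_span ⟨_, h, word_pair r s i j l m⟩

theorem relator_mem_relatorsBelow {S : Set (Rule k (Gen R n))}
    {lt : FreeMonoid (Gen R n) → FreeMonoid (Gen R n) → Prop} {σ : Rule k (Gen R n)} (hσ : σ ∈ S)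
    {A B w : FreeMonoid (Gen R n)} (h : lt (A * σ.1 * B) w) :
    word k A * (word k σ.1 - σ.2) * word k B ∈ relatorsBelow S lt w :=
  Submodule.subset_span ⟨A, B, σ, hσ, h, rfl⟩

theorem word_of (r : R) (i j : Fin n) : word k (of (r, i, j)) = genMatrix k n r i j := by
  simp [word, genMatrix]

theorem conj_sum (r s : R) (F : GL (Fin n) k) (i j : Fin n) :
    ∑ t : Fin n × Fin n × Fin n, ((F⁻¹ : GL (Fin n) k) i t.1 * F t.2.1 t.2.2) •
        (relU r s F t.1 t.2.1 * genMatrix k n s j t.2.2) =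
      ∑ t : Fin n × Fin n × Fin n, ((F⁻¹ : GL (Fin n) k) t.1 t.2.1 * F t.2.2 j) •
        (genMatrix k n s t.1 i * relT r s F t.2.1 t.2.2) := by
  have key := congrFun (congrFun (relU_conj (k := k) (n := n) r s F) i) j
  simp only [Matrix.mul_apply, scalarMatrix, Matrix.map_apply, Matrix.transpose_apply,
    Finset.sum_mul, Finset.mul_sum] at key
  simp only [Fintype.sum_prod_type]
  refine Eq.trans ?_ (key.trans ?_)
  · rw [Finset.sum_comm]
    refine (Finset.sum_congr rfl fun b _ => Finset.sum_comm).trans ?_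
    rw [Finset.sum_comm]
    refine Finset.sum_congr rfl fun c _ => Finset.sum_congr rfl fun b _ =>
      Finset.sum_congr rfl fun a _ => ?_
    rw [← Algebra.commutes, ← mul_assoc, ← map_mul, ← Algebra.smul_def, smul_mul_assoc, mul_comm]
  · refine Finset.sum_congr rfl fun d _ => ?_
    rw [Finset.sum_comm]
    refine Finset.sum_congr rfl fun b _ => Finset.sum_congr rfl fun c _ => ?_
    rw [← Algebra.commutes, ← mul_assoc (algebraMap k _ _), ← map_mul, ← Algebra.smul_def,
      mul_smul_comm, mul_comm (F c j)]

variable [NeZero n]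

/-- The system with the reductions `red1` and `red4` for the pairs in `E` and the twisted
reductions `red5` and `red6` for the pairs in `O`. -/
def edgeReductions (E : R → R → Prop) (O : R → R → GL (Fin n) k → Prop) : Set (Rule k (Gen R n)) :=
  {σ | (∃ r s, E r s ∧ σ ∈ evenRules k r s) ∨
    ∃ r s F, O r s F ∧ ∃ i j, σ = twistedRed5 r s F i j ∨ σ = twistedRed6 r s F i j}

/-- The conditions on `E` and `O` under which the system `edgeReductions E O` is confluent. -/
structure IsEdgeSystem (par : R → Bool) (E : R → R → Prop) (O : R → R → GL (Fin n) k → Prop) :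
    Prop where
  even : ∀ {r s}, E r s → par r = true ∧ par s = false
  even_right : ∀ {r s s'}, E r s → E r s' → s = s'
  even_left : ∀ {r r' s}, E r s → E r' s → r = r'
  odd : ∀ {r s F}, O r s F → par r = false ∧ par s = true
  odd_right : ∀ {r s s' F F'}, O r s F → O r s' F' → s = s' ∧ F = F'
  odd_left : ∀ {r r' s F F'}, O r s F → O r' s F' → r = r' ∧ F = F'
  upper : ∀ {r s F}, O r s F → ∀ i j : Fin n, j < i → F i j = 0

variable {E : R → R → Prop} {O : R → R → GL (Fin n) k → Prop}

theorem mem_edgeReductions_cases {σ : Rule k (Gen R n)} (hσ : σ ∈ edgeReductions E O) :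
    (∃ r s i j, E r s ∧ σ = red1 k r s i j) ∨ (∃ r s i j, E r s ∧ σ = red4 k r s i j) ∨
    (∃ r s F i j, O r s F ∧ σ = twistedRed5 r s F i j) ∨
    (∃ r s F i j, O r s F ∧ σ = twistedRed6 r s F i j) := by
  rcases hσ with ⟨r, s, h, i, j, rfl | rfl⟩ | ⟨r, s, F, h, i, j, rfl | rfl⟩
  · exact Or.inl ⟨r, s, i, j, h, rfl⟩
  · exact Or.inr (Or.inl ⟨r, s, i, j, h, rfl⟩)
  · exact Or.inr (Or.inr (Or.inl ⟨r, s, F, i, j, h, rfl⟩))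
  · exact Or.inr (Or.inr (Or.inr ⟨r, s, F, i, j, h, rfl⟩))

theorem red1_mem {r s : R} (h : E r s) (i j : Fin n) : red1 k r s i j ∈ edgeReductions E O :=
  Or.inl ⟨r, s, h, i, j, Or.inl rfl⟩

theorem red4_mem {r s : R} (h : E r s) (i j : Fin n) : red4 k r s i j ∈ edgeReductions E O :=
  Or.inl ⟨r, s, h, i, j, Or.inr rfl⟩

theorem twistedRed5_mem {r s : R} {F : GL (Fin n) k} (h : O r s F) (i j : Fin n) :
    twistedRed5 r s F i j ∈ edgeReductions E O :=
  Or.inr ⟨r, s, F, h, i, j, Or.inl rfl⟩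

theorem twistedRed6_mem {r s : R} {F : GL (Fin n) k} (h : O r s F) (i j : Fin n) :
    twistedRed6 r s F i j ∈ edgeReductions E O :=
  Or.inr ⟨r, s, F, h, i, j, Or.inr rfl⟩

theorem coe_first : ((first : Fin n) : ℕ) = 0 := rfl

theorem coe_last : ((last : Fin n) : ℕ) = n - 1 := rfl

namespace IsEdgeSystem

/-- For `red5` nonzero terms have `u ≤ j` and `l ≤ p`. Either `u < j` lowers a row weight, or `u =
j`, and then `p` exceeds the first index, as `p = 1` would force `l = 1`. Reading columns from the
right makes `p` count before `l`; reading rows from the left does the same for `u` before `l` in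
`red6`. -/
theorem compatible (h : IsEdgeSystem par E O) {σ : Rule k (Gen R n)}
    (hσ : σ ∈ edgeReductions E O) : σ.2 ∈ wordsBelow k (wordLt par) σ.1 := by
  have hn : 0 < n := NeZero.pos n
  rcases mem_edgeReductions_cases hσ with ⟨r, s, i, j, he, rfl⟩ | ⟨r, s, i, j, he, rfl⟩ |
    ⟨r, s, F, i, j, ho, rfl⟩ | ⟨r, s, F, i, j, ho, rfl⟩
  · obtain ⟨hr, hs⟩ := h.even he
    refine sub_mem (kron_mem_wordsBelow _ _ _ _) (sum_mem fun a ha => ?_)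
    refine genMatrix_mul_mem_wordsBelow ?_
    simp only [Finset.mem_filter, Finset.mem_univ, true_and, Fin.lt_def, coe_last] at ha
    simp only [red1, pair, wordLt_pair_iff, rowKey, colKey, hr, hs, coe_last, if_true]
    simp
    lia
  · obtain ⟨hr, hs⟩ := h.even he
    refine sub_mem (kron_mem_wordsBelow _ _ _ _) (sum_mem fun a ha => ?_)
    refine genMatrix_mul_mem_wordsBelow ?_
    simp only [Finset.mem_filter, Finset.mem_univ, true_and, Fin.lt_def, coe_first] at ha
    simp only [red4, pair, wordLt_pair_iff, rowKey, colKey, hr, hs, coe_first, if_true]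
    simp
    lia
  · obtain ⟨hr, hs⟩ := h.odd ho
    refine Submodule.smul_mem _ _
      (sub_mem (kron_mem_wordsBelow _ _ _ _) (sum_mem fun ⟨l, p, u⟩ ht => ?_))
    by_cases hc : (F l p * (F⁻¹ : GL (Fin n) k) u j) = 0
    · simp only [hc, zero_smul, zero_mem]
    refine Submodule.smul_mem _ _ (genMatrix_mul_mem_wordsBelow ?_)
    have h1 : l ≤ p := not_lt.1 fun hlt => hc (by rw [h.upper ho _ _ hlt, zero_mul])
    have h2 : u ≤ j := not_lt.1 fun hlt => hc (by rw [inv_upper (h.upper ho) _ _ hlt, mul_zero])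
    simp only [Finset.mem_filter, Finset.mem_univ, true_and, ne_eq, Prod.mk.injEq, Fin.ext_iff,
      coe_first] at ht
    simp only [twistedRed5, pair, wordLt_pair_iff, rowKey, colKey, hr, hs, coe_first, if_true]
    simp
    lia
  · obtain ⟨hr, hs⟩ := h.odd ho
    refine Submodule.smul_mem _ _
      (sub_mem (kron_mem_wordsBelow _ _ _ _) (sum_mem fun ⟨p, u, l⟩ ht => ?_))
    by_cases hc : (F i p * (F⁻¹ : GL (Fin n) k) u l) = 0
    · simp only [hc, zero_smul, zero_mem]
    refine Submodule.smul_mem _ _ (genMatrix_mul_mem_wordsBelow ?_)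
    have h1 : i ≤ p := not_lt.1 fun hlt => hc (by rw [h.upper ho _ _ hlt, zero_mul])
    have h2 : u ≤ l := not_lt.1 fun hlt => hc (by rw [inv_upper (h.upper ho) _ _ hlt, mul_zero])
    simp only [Finset.mem_filter, Finset.mem_univ, true_and, ne_eq, Prod.mk.injEq, Fin.ext_iff,
      coe_last] at ht
    simp only [twistedRed6, pair, wordLt_pair_iff, rowKey, colKey, hr, hs, coe_last, if_true]
    simp
    lia

theorem isCompatibleOrder (h : IsEdgeSystem par E O) :
    IsCompatibleOrder (edgeReductions E O) (wordLt par) where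
  strictOrder := wordLt_isStrictOrder par
  semigroup := wordLt_semigroup par
  descendingChain := wordLt_wellFounded par
  compatible _ hσ := h.compatible hσ

end IsEdgeSystem

theorem relP_mem {lt : FreeMonoid (Gen R n) → FreeMonoid (Gen R n) → Prop} {r s : R} (he : E r s)
    {i j : Fin n} (A B : FreeMonoid (Gen R n)) {w : FreeMonoid (Gen R n)}
    (h : lt (A * pair r i last s j last * B) w) :
    word k A * relP k r s i j * word k B ∈ relatorsBelow (edgeReductions E O) lt w := by
  rw [← red1_sub]
  exact relator_mem_relatorsBelow (red1_mem he i j) h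

theorem relQ_mem {lt : FreeMonoid (Gen R n) → FreeMonoid (Gen R n) → Prop} {r s : R} (he : E r s)
    {i j : Fin n} (A B : FreeMonoid (Gen R n)) {w : FreeMonoid (Gen R n)}
    (h : lt (A * pair s first i r first j * B) w) :
    word k A * relQ k r s i j * word k B ∈ relatorsBelow (edgeReductions E O) lt w := by
  rw [← red4_sub]
  exact relator_mem_relatorsBelow (red4_mem he i j) h

theorem relT_eq (r s : R) {F : GL (Fin n) k} (hF : ∀ i j : Fin n, j < i → F i j = 0)
    (i j : Fin n) : relT r s F i j = (F first first * (F j j)⁻¹) •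
      (word k (twistedRed5 r s F i j).1 - (twistedRed5 r s F i j).2) := by
  have h1 := diag_ne_zero hF first
  have h2 := diag_ne_zero hF j
  rw [twistedRed5_sub r s hF, smul_smul,
    show F first first * (F j j)⁻¹ * ((F first first)⁻¹ * F j j) = 1 by field_simp, one_smul]

theorem relU_eq (r s : R) {F : GL (Fin n) k} (hF : ∀ i j : Fin n, j < i → F i j = 0)
    (i j : Fin n) : relU r s F i j = (F i i * (F last last)⁻¹) •
      (word k (twistedRed6 r s F i j).1 - (twistedRed6 r s F i j).2) := by
  have h1 := diag_ne_zero hF i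
  have h2 := diag_ne_zero hF last
  rw [twistedRed6_sub r s hF, smul_smul,
    show F i i * (F last last)⁻¹ * ((F i i)⁻¹ * F last last) = 1 by field_simp, one_smul]

theorem relT_mem {lt : FreeMonoid (Gen R n) → FreeMonoid (Gen R n) → Prop} {r s : R}
    {F : GL (Fin n) k} (hF : ∀ i j : Fin n, j < i → F i j = 0) (ho : O r s F)
    {i j : Fin n} (A B : FreeMonoid (Gen R n)) {w : FreeMonoid (Gen R n)}
    (h : lt (A * pair r i first s j first * B) w) :
    word k A * relT r s F i j * word k B ∈ relatorsBelow (edgeReductions E O) lt w := by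
  rw [relT_eq r s hF, mul_smul_comm, smul_mul_assoc]
  exact Submodule.smul_mem _ _ (relator_mem_relatorsBelow (twistedRed5_mem ho i j) h)

theorem relU_mem {lt : FreeMonoid (Gen R n) → FreeMonoid (Gen R n) → Prop} {r s : R}
    {F : GL (Fin n) k} (hF : ∀ i j : Fin n, j < i → F i j = 0) (ho : O r s F)
    {i j : Fin n} (A B : FreeMonoid (Gen R n)) {w : FreeMonoid (Gen R n)}
    (h : lt (A * pair s last i r last j * B) w) :
    word k A * relU r s F i j * word k B ∈ relatorsBelow (edgeReductions E O) lt w := by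
  rw [relU_eq r s hF, mul_smul_comm, smul_mul_assoc]
  exact Submodule.smul_mem _ _ (relator_mem_relatorsBelow (twistedRed6_mem ho i j) h)

/-- This isolates the leading term on each side of a matrix identity; the remaining terms are
absorbed by the subspace of smaller relators. -/
theorem sub_mem_of_sum_eq {ι κ M : Type*} [Fintype ι] [Fintype κ] [AddCommGroup M] [Module k M]
    (p : Submodule k M) {f : ι → M} {g : κ → M} (h : ∑ a, f a = ∑ b, g b) (a₀ : ι) (b₀ : κ)
    (hf : ∀ a, a ≠ a₀ → f a ∈ p) (hg : ∀ b, b ≠ b₀ → g b ∈ p) : f a₀ - g b₀ ∈ p := by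
  classical
  rw [← Finset.add_sum_erase Finset.univ f (Finset.mem_univ a₀),
    ← Finset.add_sum_erase Finset.univ g (Finset.mem_univ b₀)] at h
  have h1 : f a₀ - g b₀ =
      ∑ b ∈ Finset.univ.erase b₀, g b - ∑ a ∈ Finset.univ.erase a₀, f a := by
    rw [sub_eq_sub_iff_add_eq_add, h, add_comm]
  rw [h1]
  exact sub_mem (sum_mem fun b hb => hg b (Finset.ne_of_mem_erase hb))
    (sum_mem fun a ha => hf a (Finset.ne_of_mem_erase ha))

namespace IsEdgeSystem

/-- In the `(i, j)` entry of `P X = X Q`, the summand with first inner index on the left and the one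
with last inner index on the right are the two relators of the ambiguity. -/
theorem overlap_red1_red4 (h : IsEdgeSystem par E O) {r s : R} (he : E r s) (i j : Fin n) :
    relator 1 (red1 k r s i first) (of (r, first, j)) -
        relator (of (r, i, last)) (red4 k r s last j) 1 ∈
      relatorsBelow (edgeReductions E O) (wordLt par)
        (of (r, i, last) * (of (s, first, last) * of (r, first, j))) := by
  have hn : 0 < n := NeZero.pos n
  obtain ⟨hr, hs⟩ := h.even he
  have key := congrFun (congrFun (relP_mul (k := k) (n := n) r s) i) j
  rw [Matrix.mul_apply, Matrix.mul_apply] at key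
  simp only [relator, red1_sub, red4_sub, map_one, one_mul, mul_one, word_of]
  refine sub_mem_of_sum_eq _ key first last (fun b hb => ?_) (fun a ha => ?_)
  · have := relP_mem (k := k) (O := O) (lt := wordLt par) he (i := i) (j := b) 1 (of (r, b, j))
      (w := of (r, i, last) * (of (s, first, last) * of (r, first, j))) ?_
    · simpa [word_of] using this
    · rw [← first_lt_iff, Fin.lt_def, coe_first] at hb
      simp only [pair, one_mul, mul_assoc, wordLt_triple_iff, rowKey, colKey, hr, hs, coe_first,
        coe_last, if_true]
      simp
      lia
  · have := relQ_mem (k := k) (O := O) (lt := wordLt par) he (i := a) (j := j) (of (r, i, a)) 1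
      (w := of (r, i, last) * (of (s, first, last) * of (r, first, j))) ?_
    · simpa [word_of] using this
    · rw [← lt_last_iff, Fin.lt_def, coe_last] at ha
      simp only [pair, mul_one, wordLt_triple_iff, rowKey, colKey, hr, hs, coe_first,
        coe_last, if_true]
      simp
      lia

theorem overlap_red4_red1 (h : IsEdgeSystem par E O) {r s : R} (he : E r s) (i j : Fin n) :
    relator 1 (red4 k r s i last) (of (s, j, last)) -
        relator (of (s, first, i)) (red1 k r s first j) 1 ∈
      relatorsBelow (edgeReductions E O) (wordLt par)
        (of (s, first, i) * (of (r, first, last) * of (s, j, last))) := by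
  have hn : 0 < n := NeZero.pos n
  obtain ⟨hr, hs⟩ := h.even he
  have key := congrFun (congrFun (relQ_mul (k := k) (n := n) r s) i) j
  rw [Matrix.mul_apply, Matrix.mul_apply] at key
  simp only [Matrix.transpose_apply] at key
  simp only [relator, red1_sub, red4_sub, map_one, one_mul, mul_one, word_of]
  refine sub_mem_of_sum_eq _ key last first (fun a ha => ?_) (fun b hb => ?_)
  · have := relQ_mem (k := k) (O := O) (lt := wordLt par) he (i := i) (j := a) 1 (of (s, j, a))
      (w := of (s, first, i) * (of (r, first, last) * of (s, j, last))) ?_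
    · simpa [word_of] using this
    · rw [← lt_last_iff, Fin.lt_def, coe_last] at ha
      simp only [pair, one_mul, mul_assoc, wordLt_triple_iff, rowKey, colKey, hr, hs, coe_first,
        coe_last, if_true]
      simp
      lia
  · have := relP_mem (k := k) (O := O) (lt := wordLt par) he (i := b) (j := j) (of (s, b, i)) 1
      (w := of (s, first, i) * (of (r, first, last) * of (s, j, last))) ?_
    · simpa [word_of] using this
    · rw [← first_lt_iff, Fin.lt_def, coe_first] at hb
      simp only [pair, mul_one, wordLt_triple_iff, rowKey, colKey, hr, hs, coe_first,
        coe_last, if_true]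
      simp
      lia

theorem overlap_red5_red6 (h : IsEdgeSystem par E O) {r s : R} {F : GL (Fin n) k} (ho : O r s F)
    (i j : Fin n) :
    relator 1 (twistedRed5 r s F i last) (of (r, last, j)) -
        relator (of (r, i, first)) (twistedRed6 r s F first j) 1 ∈
      relatorsBelow (edgeReductions E O) (wordLt par)
        (of (r, i, first) * (of (s, last, first) * of (r, last, j))) := by
  have hn : 0 < n := NeZero.pos n
  obtain ⟨hr, hs⟩ := h.odd ho
  have hF := h.upper ho
  have key := congrFun (congrFun (relT_mul (k := k) (n := n) r s F) i) j
  rw [Matrix.mul_apply, Matrix.mul_apply] at key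
  simp only [relator, twistedRed5_sub r s hF, twistedRed6_sub r s hF, map_one, one_mul, mul_one,
    word_of, smul_mul_assoc, mul_smul_comm, ← smul_sub]
  -- Both rules carry the same normalising scalar `F₁₁⁻¹ Fₙₙ`, which has been factored out.
  refine Submodule.smul_mem _ _
    (sub_mem_of_sum_eq _ key last first (fun b hb => ?_) (fun a ha => ?_))
  · have := relT_mem (k := k) (E := E) (lt := wordLt par) hF ho (i := i) (j := b) 1 (of (r, b, j))
      (w := of (r, i, first) * (of (s, last, first) * of (r, last, j))) ?_
    · simpa [word_of] using this
    · rw [← lt_last_iff, Fin.lt_def, coe_last] at hb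
      simp only [pair, one_mul, mul_assoc, wordLt_triple_iff, rowKey, colKey, hr, hs, coe_first,
        coe_last, if_true]
      simp
      lia
  · have := relU_mem (k := k) (E := E) (lt := wordLt par) hF ho (i := a) (j := j) (of (r, i, a)) 1
      (w := of (r, i, first) * (of (s, last, first) * of (r, last, j))) ?_
    · simpa [word_of] using this
    · rw [← first_lt_iff, Fin.lt_def, coe_first] at ha
      simp only [pair, mul_one, wordLt_triple_iff, rowKey, colKey, hr, hs, coe_first,
        coe_last, if_true]
      simp
      lia

/-- The conjugated identity is needed here. Triangularity of `F` and `F⁻¹` removes the terms whose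
leading word would exceed the ambiguous one. -/
theorem overlap_red6_red5 (h : IsEdgeSystem par E O) {r s : R} {F : GL (Fin n) k} (ho : O r s F)
    (i j : Fin n) :
    relator 1 (twistedRed6 r s F i first) (of (s, j, first)) -
        relator (of (s, last, i)) (twistedRed5 r s F last j) 1 ∈
      relatorsBelow (edgeReductions E O) (wordLt par)
        (of (s, last, i) * (of (r, last, first) * of (s, j, first))) := by
  have hn : 0 < n := NeZero.pos n
  obtain ⟨hr, hs⟩ := h.odd ho
  have hF := h.upper ho
  have key := conj_sum r s F i j
  have h1 := diag_ne_zero hF i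
  have h2 := diag_ne_zero hF j
  have h3 := diag_ne_zero hF first
  have h4 := diag_ne_zero hF last
  have main := sub_mem_of_sum_eq
    (relatorsBelow (edgeReductions E O) (wordLt par)
      (of (s, last, i) * (of (r, last, first) * of (s, j, first)))) key
    (i, first, first) (last, last, j) ?_ ?_
  · simp only [relU_eq r s hF, relT_eq r s hF, inv_diag hF, smul_mul_assoc, mul_smul_comm,
      smul_smul] at main
    -- The two leading terms carry the common coefficient `F₁₁ Fₙₙ⁻¹`, which is cancelled.
    have := Submodule.smul_mem _ (F last last * (F first first)⁻¹) main
    rw [smul_sub, smul_smul, smul_smul,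
      show F last last * (F first first)⁻¹ * ((F i i)⁻¹ * F first first *
        (F i i * (F last last)⁻¹)) = 1 by field_simp,
      show F last last * (F first first)⁻¹ * ((F last last)⁻¹ * F j j *
        (F first first * (F j j)⁻¹)) = 1 by field_simp, one_smul, one_smul] at this
    simpa only [relator, map_one, one_mul, mul_one, word_of] using this
  · rintro ⟨a, b, c⟩ ht
    by_cases hc : (F⁻¹ : GL (Fin n) k) i a * F b c = 0
    · simp only [hc, zero_smul, zero_mem]
    have h5 : i ≤ a := not_lt.1 fun hlt => hc (by rw [inv_upper hF _ _ hlt, zero_mul])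
    have h6 : b ≤ c := not_lt.1 fun hlt => hc (by rw [hF _ _ hlt, mul_zero])
    refine Submodule.smul_mem _ _ ?_
    have := relU_mem (k := k) (E := E) (lt := wordLt par) hF ho (i := a) (j := b) 1 (of (s, j, c))
      (w := of (s, last, i) * (of (r, last, first) * of (s, j, first))) ?_
    · simpa [word_of] using this
    · simp only [ne_eq, Prod.mk.injEq, Fin.ext_iff, coe_first] at ht
      simp only [pair, one_mul, mul_assoc, wordLt_triple_iff, rowKey, colKey, hr, hs, coe_first,
        coe_last, if_true]
      simp
      lia
  · rintro ⟨a, b, c⟩ ht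
    by_cases hc : (F⁻¹ : GL (Fin n) k) a b * F c j = 0
    · simp only [hc, zero_smul, zero_mem]
    have h5 : a ≤ b := not_lt.1 fun hlt => hc (by rw [inv_upper hF _ _ hlt, zero_mul])
    have h6 : c ≤ j := not_lt.1 fun hlt => hc (by rw [hF _ _ hlt, mul_zero])
    refine Submodule.smul_mem _ _ ?_
    have := relT_mem (k := k) (E := E) (lt := wordLt par) hF ho (i := b) (j := c) (of (s, a, i)) 1
      (w := of (s, last, i) * (of (r, last, first) * of (s, j, first))) ?_
    · simpa [word_of] using this
    · simp only [ne_eq, Prod.mk.injEq, Fin.ext_iff, coe_last] at ht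
      simp only [pair, mul_one, wordLt_triple_iff, rowKey, colKey, hr, hs, coe_first,
        coe_last, if_true]
      simp
      lia

/-- Both rules rewrite the same word. In the trace identity for `P` and `U` it is the leading word
of the `(n, n)` term on either side, while terms below the diagonal of `F⁻¹` vanish. -/
theorem inclusion_red1_red6 (h : IsEdgeSystem par E O) {r s : R} {F : GL (Fin n) k} (he : E r s)
    (ho : O s r F) :
    relator 1 (red1 k r s last last) 1 - relator 1 (twistedRed6 s r F last last) 1 ∈
      relatorsBelow (edgeReductions E O) (wordLt par) (pair r last last s last last) := by
  have hn : 0 < n := NeZero.pos n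
  obtain ⟨hr, hs⟩ := h.even he
  have hF := h.upper ho
  have h1 := diag_ne_zero hF last
  have main := sub_mem_of_sum_eq
    (relatorsBelow (edgeReductions E O) (wordLt par) (pair r last last s last last))
    (sum_smul_relP r s F) (last, last) (last, last) ?_ ?_
  · simp only [relU_eq s r hF, inv_diag hF, ← red1_sub, smul_smul] at main
    have := Submodule.smul_mem _ (F last last) main
    rw [smul_sub, smul_smul, smul_smul, mul_inv_cancel₀ h1, mul_one, mul_inv_cancel₀ h1,
      one_smul, one_smul] at this
    simpa only [relator, map_one, one_mul, mul_one] using this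
  · rintro ⟨u, l⟩ ht
    by_cases hc : (F⁻¹ : GL (Fin n) k) u l = 0
    · simp only [hc, zero_smul, zero_mem]
    have h5 : u ≤ l := not_lt.1 fun hlt => hc (inv_upper hF _ _ hlt)
    refine Submodule.smul_mem _ _ ?_
    have := relP_mem (k := k) (O := O) (lt := wordLt par) he (i := u) (j := l) 1 1
      (w := pair r last last s last last) ?_
    · simpa using this
    · simp only [ne_eq, Prod.mk.injEq, Fin.ext_iff, coe_last] at ht
      simp only [pair, one_mul, mul_one, wordLt_pair_iff, rowKey, colKey, hr, hs,
        coe_last, if_true]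
      simp
      lia
  · rintro ⟨i, j⟩ ht
    by_cases hc : (F⁻¹ : GL (Fin n) k) j i = 0
    · simp only [hc, zero_smul, zero_mem]
    have h5 : j ≤ i := not_lt.1 fun hlt => hc (inv_upper hF _ _ hlt)
    refine Submodule.smul_mem _ _ ?_
    have := relU_mem (k := k) (E := E) (lt := wordLt par) hF ho (i := i) (j := j) 1 1
      (w := pair r last last s last last) ?_
    · simpa using this
    · simp only [ne_eq, Prod.mk.injEq, Fin.ext_iff, coe_last] at ht
      simp only [pair, one_mul, mul_one, wordLt_pair_iff, rowKey, colKey, hr, hs,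
        coe_last, if_true]
      simp
      lia

theorem inclusion_red4_red5 (h : IsEdgeSystem par E O) {r s : R} {F : GL (Fin n) k} (he : E r s)
    (ho : O s r F) :
    relator 1 (red4 k r s first first) 1 - relator 1 (twistedRed5 s r F first first) 1 ∈
      relatorsBelow (edgeReductions E O) (wordLt par) (pair s first first r first first) := by
  have hn : 0 < n := NeZero.pos n
  obtain ⟨hr, hs⟩ := h.even he
  have hF := h.upper ho
  have h1 := diag_ne_zero hF first
  have main := sub_mem_of_sum_eq
    (relatorsBelow (edgeReductions E O) (wordLt par) (pair s first first r first first))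
    (sum_smul_relQ r s F) (first, first) (first, first) ?_ ?_
  · simp only [relT_eq s r hF, ← red4_sub, smul_smul] at main
    have := Submodule.smul_mem _ (F first first)⁻¹ main
    rw [smul_sub, smul_smul, smul_smul, mul_inv_cancel₀ h1, mul_one, inv_mul_cancel₀ h1,
      one_smul, one_smul] at this
    simpa only [relator, map_one, one_mul, mul_one] using this
  · rintro ⟨l, p⟩ ht
    by_cases hc : F l p = 0
    · simp only [hc, zero_smul, zero_mem]
    have h5 : l ≤ p := not_lt.1 fun hlt => hc (hF _ _ hlt)
    refine Submodule.smul_mem _ _ ?_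
    have := relQ_mem (k := k) (O := O) (lt := wordLt par) he (i := l) (j := p) 1 1
      (w := pair s first first r first first) ?_
    · simpa using this
    · simp only [ne_eq, Prod.mk.injEq, Fin.ext_iff, coe_first] at ht
      simp only [pair, one_mul, mul_one, wordLt_pair_iff, rowKey, colKey, hr, hs,
        coe_first, if_true]
      simp
      lia
  · rintro ⟨i, j⟩ ht
    by_cases hc : F j i = 0
    · simp only [hc, zero_smul, zero_mem]
    have h5 : j ≤ i := not_lt.1 fun hlt => hc (hF _ _ hlt)
    refine Submodule.smul_mem _ _ ?_
    have := relT_mem (k := k) (E := E) (lt := wordLt par) hF ho (i := i) (j := j) 1 1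
      (w := pair s first first r first first) ?_
    · simpa using this
    · simp only [ne_eq, Prod.mk.injEq, Fin.ext_iff, coe_first] at ht
      simp only [pair, one_mul, mul_one, wordLt_pair_iff, rowKey, colKey, hr, hs,
        coe_first, if_true]
      simp
      lia

end IsEdgeSystem

end EdgeSystem

/-! ### Classification of the ambiguities -/

section Confluence

open FreeMonoid

theorem of_mul_of_eq_mul {X : Type*} {a b : X} {A B : FreeMonoid X} (h : of a * of b = A * B)
    (hA : A ≠ 1) (hB : B ≠ 1) : A = of a ∧ B = of b := by
  have h' : [a, b] = A.toList ++ B.toList := by simpa using congrArg toList h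
  have hA' : A.toList ≠ [] := fun e => hA (toList.injective e)
  have hB' : B.toList ≠ [] := fun e => hB (toList.injective e)
  rcases hl : A.toList with _ | ⟨x, l⟩
  · exact absurd hl hA'
  rcases hm : B.toList with _ | ⟨y, m⟩
  · exact absurd hm hB'
  rw [hl, hm] at h'
  rcases l with _ | ⟨z, l⟩
  · simp at h'
    obtain ⟨rfl, rfl, rfl⟩ := h'
    exact ⟨toList.injective hl, toList.injective hm⟩
  · simp at h'

theorem of_mul_of_eq_mul_mul {X : Type*} {a b c e : X} {A C : FreeMonoid X}
    (h : of a * of b = A * (of c * of e) * C) : A = 1 ∧ C = 1 ∧ a = c ∧ b = e := by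
  have h' : [a, b] = A.toList ++ ([c, e] ++ C.toList) := by
    simpa [mul_assoc] using congrArg toList h
  have hl := congrArg List.length h'
  simp at hl
  have hA : A.toList = [] := List.length_eq_zero_iff.1 (by lia)
  have hC : C.toList = [] := List.length_eq_zero_iff.1 (by lia)
  rw [hA, hC] at h'
  simp at h'
  exact ⟨toList.injective hA, toList.injective hC, h'⟩

theorem first_ne_last {n : ℕ} [NeZero n] (hn : 2 ≤ n) : (first : Fin n) ≠ last := by
  simp only [first, last, ne_eq, Fin.mk.injEq]
  lia

variable {k : Type*} [Field k] {n : ℕ} [NeZero n] {R : Type*} {par : R → Bool}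
variable {E : R → R → Prop} {O : R → R → GL (Fin n) k → Prop}

namespace IsEdgeSystem

/-- Left-hand sides have two letters, so an overlap shares one letter and an inclusion is an
equality of words. Parity of the superscripts, or `first ≠ last` (here `n ≥ 2` is used), excludes
all overlaps but the four treated above; uniqueness of neighbours then identifies the superscripts
and `F`. Among inclusions, distinct rules meet only as `red1`/`red6` or `red4`/`red5`. -/
theorem resolvableRelative (h : IsEdgeSystem par E O) (hn : 2 ≤ n) :
    ResolvableRelative (edgeReductions E O) (wordLt par) where
  overlap := by
    have hfl := first_ne_last hn
    intro σ hσ τ hτ A B C hA hB hC h1 h2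
    rcases mem_edgeReductions_cases hσ with ⟨r, s, i, j, he, rfl⟩ | ⟨r, s, i, j, he, rfl⟩ |
      ⟨r, s, F, i, j, he, rfl⟩ | ⟨r, s, F, i, j, he, rfl⟩ <;>
    obtain ⟨rfl, rfl⟩ := of_mul_of_eq_mul h1 hA hB <;>
    rcases mem_edgeReductions_cases hτ with ⟨r', s', i', j', he', rfl⟩ | ⟨r', s', i', j', he', rfl⟩ |
      ⟨r', s', F', i', j', he', rfl⟩ | ⟨r', s', F', i', j', he', rfl⟩ <;>
    obtain ⟨h3, rfl⟩ := of_mul_of_eq_mul h2 hB hC <;>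
    have h4 := of_injective h3 <;>
    simp only [Prod.mk.injEq] at h4 <;>
    obtain ⟨rfl, h5, h6⟩ := h4
    · have := h.even he; have := h.even he'; simp_all
    · subst h5 h6
      obtain rfl := h.even_left he he'
      rw [mul_assoc]
      exact h.overlap_red1_red4 he i j'
    · exact absurd h6 hfl.symm
    · have := h.even he; have := h.odd he'; simp_all
    · subst h5 h6
      obtain rfl := h.even_right he he'
      rw [mul_assoc]
      exact h.overlap_red4_red1 he i j'
    · have := h.even he; have := h.even he'; simp_all
    · have := h.even he; have := h.odd he'; simp_all
    · exact absurd h5 hfl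
    · exact absurd h6 hfl
    · have := h.even he'; have := h.odd he; simp_all
    · have := h.odd he; have := h.odd he'; simp_all
    · subst h5 h6
      obtain ⟨rfl, rfl⟩ := h.odd_left he he'
      rw [mul_assoc]
      exact h.overlap_red5_red6 he i j'
    · have := h.even he'; have := h.odd he; simp_all
    · exact absurd h5 hfl.symm
    · subst h5 h6
      obtain ⟨rfl, rfl⟩ := h.odd_right he he'
      rw [mul_assoc]
      exact h.overlap_red6_red5 he i j'
    · have := h.odd he; have := h.odd he'; simp_all
  inclusion := by
    intro σ hσ τ hτ A C h1
    rcases mem_edgeReductions_cases hσ with ⟨r, s, i, j, he, rfl⟩ | ⟨r, s, i, j, he, rfl⟩ |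
      ⟨r, s, F, i, j, he, rfl⟩ | ⟨r, s, F, i, j, he, rfl⟩ <;>
    rcases mem_edgeReductions_cases hτ with ⟨r', s', i', j', he', rfl⟩ | ⟨r', s', i', j', he', rfl⟩ |
      ⟨r', s', F', i', j', he', rfl⟩ | ⟨r', s', F', i', j', he', rfl⟩ <;>
    obtain ⟨rfl, rfl, h2, h3⟩ := of_mul_of_eq_mul_mul h1 <;>
    simp only [Prod.mk.injEq] at h2 h3 <;>
    obtain ⟨rfl, h4, h5⟩ := h2 <;>
    obtain ⟨rfl, h6, h7⟩ := h3
    · subst h4 h6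
      rw [sub_self]; exact zero_mem _
    · have := h.even he; have := h.even he'; simp_all
    · have := h.even he; have := h.odd he'; simp_all
    · subst h4 h5 h6 h7
      exact h.inclusion_red1_red6 he he'
    · have := h.even he; have := h.even he'; simp_all
    · subst h5 h7
      rw [sub_self]; exact zero_mem _
    · subst h4 h5 h6 h7
      exact h.inclusion_red4_red5 he he'
    · have := h.even he; have := h.odd he'; simp_all
    · have := h.even he'; have := h.odd he; simp_all
    · subst h4 h5 h6 h7
      rw [← neg_mem_iff, neg_sub]
      exact h.inclusion_red4_red5 he' he
    · subst h4 h6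
      obtain ⟨-, rfl⟩ := h.odd_right he he'
      rw [sub_self]; exact zero_mem _
    · have := h.odd he; have := h.odd he'; simp_all
    · subst h4 h5 h6 h7
      rw [← neg_mem_iff, neg_sub]
      exact h.inclusion_red1_red6 he' he
    · have := h.even he'; have := h.odd he; simp_all
    · have := h.odd he; have := h.odd he'; simp_all
    · subst h5 h7
      obtain ⟨-, rfl⟩ := h.odd_right he he'
      rw [sub_self]; exact zero_mem _

end IsEdgeSystem

theorem relP_mem_relators {r s : R} (he : E r s) (i j : Fin n) :
    relP k r s i j ∈ relators (edgeReductions E O) := by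
  rw [← red1_sub]
  exact rule_mem_relators (red1_mem he i j)

theorem relQ_mem_relators {r s : R} (he : E r s) (i j : Fin n) :
    relQ k r s i j ∈ relators (edgeReductions E O) := by
  rw [← red4_sub]
  exact rule_mem_relators (red4_mem he i j)

theorem relT_mem_relators {r s : R} {F : GL (Fin n) k} (hF : ∀ i j : Fin n, j < i → F i j = 0)
    (ho : O r s F) (i j : Fin n) : relT r s F i j ∈ relators (edgeReductions E O) := by
  rw [relT_eq r s hF]
  exact Submodule.smul_mem _ _ (rule_mem_relators (twistedRed5_mem ho i j))

theorem relU_mem_relators {r s : R} {F : GL (Fin n) k} (hF : ∀ i j : Fin n, j < i → F i j = 0)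
    (ho : O r s F) (i j : Fin n) : relU r s F i j ∈ relators (edgeReductions E O) := by
  rw [relU_eq r s hF]
  exact Submodule.smul_mem _ _ (rule_mem_relators (twistedRed6_mem ho i j))

/-- The diamond lemma for the system `edgeReductions E O` and an algebra with the corresponding
relations. -/
theorem IsEdgeSystem.diamond (h : IsEdgeSystem par E O) (hn : 2 ≤ n)
    {rel : FreeGen k R n → FreeGen k R n → Prop}
    (hrel : ∀ a b, rel a b → a - b ∈ relators (edgeReductions E O))
    (heven : ∀ r s, E r s → ∀ i j, RingQuot.mkAlgHom k rel (relP k r s i j) = 0 ∧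
      RingQuot.mkAlgHom k rel (relQ k r s i j) = 0)
    (hodd : ∀ r s F, O r s F → ∀ i j, RingQuot.mkAlgHom k rel (relT r s F i j) = 0 ∧
      RingQuot.mkAlgHom k rel (relU r s F i j) = 0) :
    DiamondLemmaApplicable (edgeReductions E O) ∧
      IrreducibleWordsFormBasis (edgeReductions E O) (RingQuot.mkAlgHom k rel) := by
  have hc := h.isCompatibleOrder
  have hr := h.resolvableRelative hn
  refine ⟨hc.diamondLemmaApplicable hr, hc.basis_of_ker hr _ (RingQuot.mkAlgHom_surjective k rel)
    (mkAlgHom_eq_zero_iff rel hrel fun σ hσ => ?_)⟩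
  rw [← sub_eq_zero, ← map_sub]
  rcases mem_edgeReductions_cases hσ with ⟨r, s, i, j, he, rfl⟩ | ⟨r, s, i, j, he, rfl⟩ |
    ⟨r, s, F, i, j, ho, rfl⟩ | ⟨r, s, F, i, j, ho, rfl⟩
  · rw [red1_sub]; exact (heven r s he i j).1
  · rw [red4_sub]; exact (heven r s he i j).2
  · rw [twistedRed5_sub r s (h.upper ho), map_smul, (hodd r s F ho i j).1, smul_zero]
  · rw [twistedRed6_sub r s (h.upper ho), map_smul, (hodd r s F ho i j).2, smul_zero]

/-! ### Specialisation to `H(n)`, `H_∞(n)` and `H_d(F)` -/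

theorem mkAlgHom_sub_eq_zero {X : Type*} {rel : FreeAlgebra k X → FreeAlgebra k X → Prop}
    {a b : FreeAlgebra k X} (h : rel a b) : RingQuot.mkAlgHom k rel (a - b) = 0 := by
  rw [map_sub, RingQuot.mkAlgHom_rel k h, sub_self]

theorem mem_oddRules_iff {r s : R} {σ : Rule k (Gen R n)} : σ ∈ oddRules k r s ↔
    ∃ i j, σ = twistedRed5 r s 1 i j ∨ σ = twistedRed6 r s 1 i j := by
  simp only [twistedRed5_one, twistedRed6_one]
  rfl

theorem freeReductions_eq [Semiring R] : freeReductions k n R =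
    edgeReductions (fun r s => Even r ∧ s = r + 1) (fun r s F => Odd r ∧ s = r + 1 ∧ F = 1) := by
  ext σ
  constructor
  · rintro ⟨r, ⟨hr, hσ⟩ | ⟨hr, hσ⟩⟩
    · exact Or.inl ⟨r, _, ⟨hr, rfl⟩, hσ⟩
    · exact Or.inr ⟨r, _, _, ⟨hr, rfl, rfl⟩, mem_oddRules_iff.1 hσ⟩
  · rintro (⟨r, _, ⟨hr, rfl⟩, hσ⟩ | ⟨r, _, _, ⟨hr, rfl, rfl⟩, hσ⟩)
    · exact ⟨r, Or.inl ⟨hr, hσ⟩⟩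
    · exact ⟨r, Or.inr ⟨hr, mem_oddRules_iff.2 hσ⟩⟩

theorem free_diamond [Semiring R] [IsRightCancelAdd R] (hn : 2 ≤ n)
    (heven : ∀ r : R, Even r → par r = true ∧ par (r + 1) = false)
    (hodd : ∀ r : R, Odd r → par r = false ∧ par (r + 1) = true)
    (hpar : ∀ r : R, Even r ∨ Odd r) :
    DiamondLemmaApplicable (freeReductions k n R) ∧
      IrreducibleWordsFormBasis (freeReductions k n R) (RingQuot.mkAlgHom k (FreeRel k n R)) := by
  have hP : ∀ (r : R) (i j : Fin n),
      RingQuot.mkAlgHom k (FreeRel k n R) (relP k r (r + 1) i j) = 0 := fun r i j => by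
    rw [relP_apply]; exact mkAlgHom_sub_eq_zero (FreeRel.left r i j)
  have hQ : ∀ (r : R) (i j : Fin n),
      RingQuot.mkAlgHom k (FreeRel k n R) (relQ k r (r + 1) i j) = 0 := fun r i j => by
    rw [relQ_apply]; exact mkAlgHom_sub_eq_zero (FreeRel.right r i j)
  rw [freeReductions_eq]
  refine IsEdgeSystem.diamond (par := par) ?_ hn ?_ ?_ ?_
  · constructor
    · rintro r _ ⟨hr, rfl⟩; exact heven r hr
    · rintro r _ _ ⟨-, rfl⟩ ⟨-, rfl⟩; rfl
    · rintro r r' s ⟨-, rfl⟩ ⟨-, h⟩; exact add_right_cancel h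
    · rintro r _ _ ⟨hr, rfl, rfl⟩; exact hodd r hr
    · rintro r _ _ _ _ ⟨-, rfl, rfl⟩ ⟨-, rfl, rfl⟩; exact ⟨rfl, rfl⟩
    · rintro r r' _ _ _ ⟨-, rfl, rfl⟩ ⟨-, h, rfl⟩; exact ⟨add_right_cancel h, rfl⟩
    · rintro r _ _ ⟨-, rfl, rfl⟩; exact one_upper
  · rintro _ _ (⟨r, i, j⟩ | ⟨r, i, j⟩)
    · rw [← relP_apply]
      rcases hpar r with hr | hr
      · exact relP_mem_relators ⟨hr, rfl⟩ i j
      · rw [← relT_one]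
        exact relT_mem_relators one_upper ⟨hr, rfl, rfl⟩ i j
    · rw [← relQ_apply]
      rcases hpar r with hr | hr
      · exact relQ_mem_relators ⟨hr, rfl⟩ i j
      · rw [← relU_one]
        exact relU_mem_relators one_upper ⟨hr, rfl, rfl⟩ i j
  · rintro r _ ⟨-, rfl⟩ i j
    exact ⟨hP r i j, hQ r i j⟩
  · rintro r _ _ ⟨-, rfl, rfl⟩ i j
    rw [relT_one, relU_one]
    exact ⟨hP r i j, hQ r i j⟩

theorem twistedReductions_eq (d : ℕ) (F : GL (Fin n) k) : twistedReductions d F =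
    edgeReductions
      (fun r s : ZMod (2 * d) => ∃ m : ℕ, m + 2 ≤ 2 * d ∧ Even m ∧ r = m ∧ s = m + 1)
      (fun r s F' => (∃ m : ℕ, m + 2 ≤ 2 * d ∧ Odd m ∧ r = m ∧ s = m + 1 ∧ F' = 1) ∨
        (r = -1 ∧ s = 0 ∧ F' = F)) := by
  ext σ
  constructor
  · rintro (⟨m, hm, ⟨hr, hσ⟩ | ⟨hr, hσ⟩⟩ | ⟨i, j, hσ⟩)
    · exact Or.inl ⟨_, _, ⟨m, hm, hr, rfl, rfl⟩, hσ⟩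
    · exact Or.inr ⟨_, _, _, Or.inl ⟨m, hm, hr, rfl, rfl, rfl⟩, mem_oddRules_iff.1 hσ⟩
    · exact Or.inr ⟨_, _, _, Or.inr ⟨rfl, rfl, rfl⟩, i, j, hσ⟩
  · rintro (⟨_, _, ⟨m, hm, hr, rfl, rfl⟩, hσ⟩ |
      ⟨_, _, _, ⟨m, hm, hr, rfl, rfl, rfl⟩ | ⟨rfl, rfl, rfl⟩, hσ⟩)
    · exact Or.inl ⟨m, hm, Or.inl ⟨hr, hσ⟩⟩
    · exact Or.inl ⟨m, hm, Or.inr ⟨hr, mem_oddRules_iff.2 hσ⟩⟩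
    · obtain ⟨i, j, hσ⟩ := hσ
      exact Or.inr ⟨i, j, hσ⟩

theorem twisted_diamond (hn : 2 ≤ n) (d : ℕ) (F : GL (Fin n) k) (hd : 1 ≤ d)
    (hF : ∀ i j : Fin n, j < i → F i j = 0) :
    DiamondLemmaApplicable (twistedReductions d F) ∧
      IrreducibleWordsFormBasis (twistedReductions d F)
        (RingQuot.mkAlgHom k (TwistedRel k d F)) := by
  -- As `d ≥ 1`, residues have representatives below `2d`, and since `2d` is even their parity
  -- alternates around the whole cycle. In particular `-1` is odd, and no ordinary step starts at
  -- `-1` or ends at `0`, so the closing step is the only one that does.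
  have val_m : ∀ m : ℕ, m + 2 ≤ 2 * d → ((m : ZMod (2 * d))).val = m := fun m hm =>
    ZMod.val_cast_of_lt (by lia)
  have val_succ : ∀ m : ℕ, m + 2 ≤ 2 * d → ((m : ZMod (2 * d)) + 1).val = m + 1 := fun m hm => by
    rw [← Nat.cast_succ]
    exact ZMod.val_cast_of_lt (by lia)
  have neg_one_eq : (-1 : ZMod (2 * d)) = ((2 * d - 1 : ℕ) : ZMod (2 * d)) := by
    rw [Nat.cast_sub (by lia), ZMod.natCast_self]
    simp
  have val_neg : (-1 : ZMod (2 * d)).val = 2 * d - 1 := by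
    rw [neg_one_eq]
    exact ZMod.val_cast_of_lt (by lia)
  have cast_ne : ∀ m : ℕ, m + 2 ≤ 2 * d → (m : ZMod (2 * d)) ≠ -1 := fun m hm e => by
    have := congrArg ZMod.val e
    rw [val_m m hm, val_neg] at this
    lia
  have succ_ne : ∀ m : ℕ, m + 2 ≤ 2 * d → (m : ZMod (2 * d)) + 1 ≠ 0 := fun m hm e =>
    cast_ne m hm (eq_neg_of_add_eq_zero_left e)
  have hP : ∀ m : ℕ, m + 2 ≤ 2 * d → ∀ i j : Fin n, RingQuot.mkAlgHom k (TwistedRel k d F)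
      (relP k (m : ZMod (2 * d)) (m + 1) i j) = 0 := fun m hm i j => by
    rw [relP_apply]; exact mkAlgHom_sub_eq_zero (TwistedRel.left m hm i j)
  have hQ : ∀ m : ℕ, m + 2 ≤ 2 * d → ∀ i j : Fin n, RingQuot.mkAlgHom k (TwistedRel k d F)
      (relQ k (m : ZMod (2 * d)) (m + 1) i j) = 0 := fun m hm i j => by
    rw [relQ_apply]; exact mkAlgHom_sub_eq_zero (TwistedRel.right m hm i j)
  have hT : ∀ i j : Fin n, (genMatrix k n (-1 : ZMod (2 * d)) * twist k d F) i j - kron k n i j =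
      relT (-1) 0 F i j := fun i j => by
    rw [kron_eq]; rfl
  have hU : ∀ i j : Fin n, (twist k d F * genMatrix k n (-1 : ZMod (2 * d))) i j - kron k n i j =
      relU (-1) 0 F i j := fun i j => by
    rw [kron_eq]; rfl
  rw [twistedReductions_eq]
  refine IsEdgeSystem.diamond (par := fun r => decide (Even r.val)) ?_ hn ?_ ?_ ?_
  · constructor
    · rintro _ _ ⟨m, hm, hr, rfl, rfl⟩
      simp only [val_m m hm, val_succ m hm]
      simpa [Nat.even_add_one] using hr
    · rintro _ _ _ ⟨m, hm, hr, rfl, rfl⟩ ⟨m', hm', hr', h, rfl⟩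
      rw [h]
    · rintro _ _ _ ⟨m, hm, hr, rfl, rfl⟩ ⟨m', hm', hr', rfl, h⟩
      exact add_right_cancel h
    · rintro _ _ _ (⟨m, hm, hr, rfl, rfl, rfl⟩ | ⟨rfl, rfl, rfl⟩)
      · simp only [val_m m hm, val_succ m hm]
        simpa [Nat.even_add_one] using hr
      · simp only [val_neg, ZMod.val_zero]
        have : Odd (2 * d - 1) := ⟨d - 1, by lia⟩
        simpa using this
    · rintro _ _ _ _ _ (⟨m, hm, hr, rfl, rfl, rfl⟩ | ⟨rfl, rfl, rfl⟩)
        (⟨m', hm', hr', h, rfl, rfl⟩ | ⟨h, rfl, rfl⟩)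
      · exact ⟨by rw [h], rfl⟩
      · exact absurd h (cast_ne m hm)
      · exact absurd h.symm (cast_ne m' hm')
      · exact ⟨rfl, rfl⟩
    · rintro _ _ _ _ _ (⟨m, hm, hr, rfl, rfl, rfl⟩ | ⟨rfl, rfl, rfl⟩)
        (⟨m', hm', hr', rfl, h, rfl⟩ | ⟨rfl, h, rfl⟩)
      · exact ⟨add_right_cancel h, rfl⟩
      · exact absurd h (succ_ne m hm)
      · exact absurd h.symm (succ_ne m' hm')
      · exact ⟨rfl, rfl⟩
    · rintro _ _ _ (⟨m, hm, hr, rfl, rfl, rfl⟩ | ⟨rfl, rfl, rfl⟩)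
      · exact one_upper
      · exact hF
  · rintro _ _ (⟨m, hm, i, j⟩ | ⟨m, hm, i, j⟩ | ⟨i, j⟩ | ⟨i, j⟩)
    · rw [← relP_apply]
      rcases Nat.even_or_odd m with hr | hr
      · exact relP_mem_relators ⟨m, hm, hr, rfl, rfl⟩ i j
      · rw [← relT_one]
        exact relT_mem_relators one_upper (Or.inl ⟨m, hm, hr, rfl, rfl, rfl⟩) i j
    · rw [← relQ_apply]
      rcases Nat.even_or_odd m with hr | hr
      · exact relQ_mem_relators ⟨m, hm, hr, rfl, rfl⟩ i j
      · rw [← relU_one]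
        exact relU_mem_relators one_upper (Or.inl ⟨m, hm, hr, rfl, rfl, rfl⟩) i j
    · rw [hT]
      exact relT_mem_relators hF (Or.inr ⟨rfl, rfl, rfl⟩) i j
    · rw [hU]
      exact relU_mem_relators hF (Or.inr ⟨rfl, rfl, rfl⟩) i j
  · rintro _ _ ⟨m, hm, -, rfl, rfl⟩ i j
    exact ⟨hP m hm i j, hQ m hm i j⟩
  · rintro _ _ _ (⟨m, hm, -, rfl, rfl, rfl⟩ | ⟨rfl, rfl, rfl⟩) i j
    · rw [relT_one, relU_one]
      exact ⟨hP m hm i j, hQ m hm i j⟩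
    · rw [← hT, ← hU]
      exact ⟨mkAlgHom_sub_eq_zero (TwistedRel.twistLeft i j),
        mkAlgHom_sub_eq_zero (TwistedRel.twistRight i j)⟩

end Confluence

end UniversalQuantumGroup

theorem mainTheorem6 {k : Type*} [Field k] (n : ℕ) [NeZero n] (hn : 2 ≤ n) :
    (UniversalQuantumGroup.DiamondLemmaApplicable
        (UniversalQuantumGroup.freeReductions k n ℕ) ∧
      UniversalQuantumGroup.IrreducibleWordsFormBasis
        (UniversalQuantumGroup.freeReductions k n ℕ)
        (RingQuot.mkAlgHom k (UniversalQuantumGroup.FreeRel k n ℕ))) ∧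
    (UniversalQuantumGroup.DiamondLemmaApplicable
        (UniversalQuantumGroup.freeReductions k n ℤ) ∧
      UniversalQuantumGroup.IrreducibleWordsFormBasis
        (UniversalQuantumGroup.freeReductions k n ℤ)
        (RingQuot.mkAlgHom k (UniversalQuantumGroup.FreeRel k n ℤ))) ∧
    (∀ (d : ℕ) (F : GL (Fin n) k), 1 ≤ d → (∀ i j : Fin n, j < i → F i j = 0) →
      UniversalQuantumGroup.DiamondLemmaApplicable
          (UniversalQuantumGroup.twistedReductions d F) ∧
        UniversalQuantumGroup.IrreducibleWordsFormBasis
          (UniversalQuantumGroup.twistedReductions d F)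
          (RingQuot.mkAlgHom k (UniversalQuantumGroup.TwistedRel k d F))) := by
  refine ⟨UniversalQuantumGroup.free_diamond (par := fun r => decide (Even r)) hn ?_ ?_
      Nat.even_or_odd,
    UniversalQuantumGroup.free_diamond (par := fun r => decide (Even r)) hn ?_ ?_
      Int.even_or_odd,
    fun d F hd hF => UniversalQuantumGroup.twisted_diamond hn d F hd hF⟩
  · intro r hr
    simpa [Nat.even_add_one] using hr
  · intro r hr
    simpa [Nat.even_add_one] using hr
  · intro r hr
    simpa [Int.even_add_one] using hr
  · intro r hr
    simpa [Int.even_add_one] using hr
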